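/- Let $\Bbbk$ be an algebraically closed field. Call a small $\Bbbk$-linear category \emph{finitary} if it is additive and idempotent complete, has finite dimensional morphism spaces, and has only finitely many isomorphism classes of indecomposable objects; let $\mathfrak{A}^f_{\Bbbk}$ be the $2$-category of finitary $\Bbbk$-linear categories, additive $\Bbbk$-linear functors and natural transformations. A (strict) $2$-category $\mathscr{C}$ is \emph{finitary} if it has finitely many objects up to equivalence, every category $\mathscr{C}(\mathtt{i},\mathtt{j})$ is a finitary $\Bbbk$-linear category, horizontal composition is additive and $\Bbbk$-linear, and every identity $1$-morphism $\mathbb{1}_{\mathtt{i}}$ is indecomposable. For a $2$-category $\mathscr{B}$, let $\mathscr{B}\text{-afmod}$ be the $2$-category whose objects are the homomorphisms (pseudofunctors) $\mathscr{B}\to\mathfrak{A}^f_{\Bbbk}$, whose $1$-morphisms are strong transformations and whose $2$-morphisms are modifications. A homomorphism of $2$-categories is a \emph{biequivalence} if every object of the target is equivalent to one in its image and it is an equivalence on all categories of morphisms. Let $\mathscr{C}$ be a finitary $2$-category. For objects $\mathtt{i},\mathtt{j}$ write $\mathtt{i}\preceq\mathtt{j}$ if there are $\Phi\in\mathscr{C}(\mathtt{j},\mathtt{i})$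 and $\Psi\in\mathscr{C}(\mathtt{i},\mathtt{j})$ with $\Phi\circ\Psi\cong\mathbb{1}_{\mathtt{i}}$. This is a preorder that is invariant under equivalence of objects; call $\mathtt{i}$ maximal if $\mathtt{i}\preceq\mathtt{j}$ implies $\mathtt{j}\preceq\mathtt{i}$. Let ${}^{\dagger}\mathscr{C}$ be the full $2$-subcategory of $\mathscr{C}$ given by any choice of exactly one object in each equivalence class of maximal objects. \textbf{Proposition.} The restriction homomorphism $$\mathrm{Res}:\mathscr{C}\text{-afmod}\longrightarrow{}^{\dagger}\mathscr{C}\text{-afmod}$$ is a biequivalence; in particular $\mathscr{C}\text{-afmod}$ and ${}^{\dagger}\mathscr{C}\text{-afmod}$ are biequivalent. The same holds for the restriction between the full $2$-subcategories of locally $\Bbbk$-linear $2$-representations, that is, of those homomorphisms $\mathbf{M}$ for which all functors $\mathbf{M}_{\mathtt{i},\mathtt{j}}$ on categories of morphisms are additive and $\Bbbk$-linear. -/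

import Mathlib

open CategoryTheory CategoryTheory.Limits CategoryTheory.Bicategory
open scoped CategoryTheory.Pseudofunctor.StrongTrans

universe w w₁ w₂ w₃ v v₁ v₂ v₃ u u₁ u₂ u₃

noncomputable section

namespace FinitaryMorita

/-! ### Finitary additive categories -/

/-- Indecomposable objects of a category with finite direct sums: nonzero objects that are not a
direct sum of two nonzero objects. -/
def IsIndecomposable {𝒜 : Type u} [Category.{v} 𝒜] [Preadditive 𝒜] [HasFiniteBiproducts 𝒜]
    (X : 𝒜) : Prop :=
  haveI := hasBinaryBiproducts_of_finite_biproducts 𝒜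
  Indecomposable X

/-- A `k`-linear category is finitary if it is additive, idempotent complete, has
finite dimensional morphism spaces, and has only finitely many isomorphism classes of
indecomposable objects. -/
class IsFinitaryCategory (k : Type w) [Field k] (𝒜 : Type u) [Category.{v} 𝒜] [Preadditive 𝒜]
    [Linear k 𝒜] : Prop extends HasFiniteBiproducts 𝒜, IsIdempotentComplete 𝒜 where
  finite_hom (X Y : 𝒜) : Module.Finite k (X ⟶ Y)
  finite_indecomposables : ∃ s : Set 𝒜, s.Finite ∧
    ∀ X : 𝒜, IsIndecomposable X → ∃ Y ∈ s, Nonempty (X ≅ Y)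

/-- A bundled finitary `k`-linear category: an object of `𝔄ᶠ_k`. -/
structure FinAddCat (k : Type w) [Field k] where
  carrier : Type u
  [category : Category.{v} carrier]
  [preadditive : Preadditive carrier]
  [linear : Linear k carrier]
  [finitary : IsFinitaryCategory k carrier]

attribute [instance] FinAddCat.category FinAddCat.preadditive FinAddCat.linear FinAddCat.finitary

/-- The property of a functor to be additive and `k`-linear. -/
def IsLinearFunctor (k : Type w) [Field k] (𝒜 : Type u) [Category.{v} 𝒜] [Preadditive 𝒜]
    [Linear k 𝒜] (ℬ : Type u₁) [Category.{v₁} ℬ] [Preadditive ℬ] [Linear k ℬ] :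
    ObjectProperty (𝒜 ⥤ ℬ) :=
  fun F => F.Additive ∧ F.Linear k

namespace FinAddCat

variable {k : Type w} [Field k]

/-- 1-morphisms of `𝔄ᶠ_k` are additive `k`-linear functors. -/
structure Hom (A B : FinAddCat.{w, v, u} k) where
  functor : A.carrier ⥤ B.carrier
  property : IsLinearFunctor k A.carrier B.carrier functor

@[simps id_functor comp_functor]
instance : CategoryStruct (FinAddCat.{w, v, u} k) where
  Hom A B := Hom A B
  id A := ⟨𝟭 A.carrier, inferInstance, inferInstance⟩
  comp F G := ⟨F.functor ⋙ G.functor,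
    haveI := F.property.1
    haveI := G.property.1
    inferInstance,
    haveI := F.property.2
    haveI := G.property.2
    inferInstance⟩

/-- 2-morphisms of `𝔄ᶠ_k` are all natural transformations. -/
@[ext]
structure Hom₂ {A B : FinAddCat.{w, v, u} k} (F G : A ⟶ B) where
  natTrans : F.functor ⟶ G.functor

@[simps id_natTrans comp_natTrans]
instance homCategory (A B : FinAddCat.{w, v, u} k) : Category (A ⟶ B) where
  Hom F G := Hom₂ F G
  id F := ⟨𝟙 F.functor⟩
  comp α β := ⟨α.natTrans ≫ β.natTrans⟩

@[ext]
theorem hom₂_ext {A B : FinAddCat.{w, v, u} k} {F G : A ⟶ B} {α β : F ⟶ G}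
    (h : ∀ X, α.natTrans.app X = β.natTrans.app X) : α = β :=
  Hom₂.ext (NatTrans.ext (funext h))

/-- 2-morphisms of `𝔄ᶠ_k` as natural transformations. -/
def homEquiv {A B : FinAddCat.{w, v, u} k} (F G : A ⟶ B) :
    (F ⟶ G) ≃ (F.functor ⟶ G.functor) :=
  ⟨fun α => α.natTrans, fun α => ⟨α⟩, fun _ => rfl, fun _ => rfl⟩

instance homPreadditive (A B : FinAddCat.{w, v, u} k) : Preadditive (A ⟶ B) where
  homGroup F G := (homEquiv F G).addCommGroup
  add_comp _ _ _ _ _ _ := Hom₂.ext (Preadditive.add_comp (C := _ ⥤ _) _ _ _ _ _ _)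
  comp_add _ _ _ _ _ _ := Hom₂.ext (Preadditive.comp_add (C := _ ⥤ _) _ _ _ _ _ _)

instance homLinear (A B : FinAddCat.{w, v, u} k) : Linear k (A ⟶ B) where
  homModule F G := (homEquiv F G).module k
  smul_comp _ _ _ _ _ _ := Hom₂.ext (Linear.smul_comp (C := _ ⥤ _) _ _ _ _ _ _)
  comp_smul _ _ _ _ _ _ := Hom₂.ext (Linear.comp_smul (C := _ ⥤ _) _ _ _ _ _ _)

/-- The 2-isomorphism given by a natural isomorphism. -/
@[simps]
def mkIso₂ {A B : FinAddCat.{w, v, u} k} {F G : A ⟶ B} (α : F.functor ≅ G.functor) : F ≅ G where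
  hom := ⟨α.hom⟩
  inv := ⟨α.inv⟩

/-- The 2-category `𝔄ᶠ_k`. -/
@[simps! whiskerLeft_natTrans whiskerRight_natTrans associator_hom_natTrans
  associator_inv_natTrans leftUnitor_hom_natTrans leftUnitor_inv_natTrans
  rightUnitor_hom_natTrans rightUnitor_inv_natTrans]
instance : Bicategory (FinAddCat.{w, v, u} k) where
  homCategory := homCategory
  whiskerLeft F G H α := Hom₂.mk (F := F ≫ G) (G := F ≫ H)
    (Functor.whiskerLeft F.functor α.natTrans)
  whiskerRight {_ _ _ F G} α H := Hom₂.mk (F := F ≫ H) (G := G ≫ H)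
    (Functor.whiskerRight α.natTrans H.functor)
  associator F G H := mkIso₂ (F := (F ≫ G) ≫ H) (G := F ≫ G ≫ H)
    (Functor.associator F.functor G.functor H.functor)
  leftUnitor {A _} F := mkIso₂ (F := 𝟙 A ≫ F) (G := F) (Functor.leftUnitor F.functor)
  rightUnitor {_ B} F := mkIso₂ (F := F ≫ 𝟙 B) (G := F) (Functor.rightUnitor F.functor)

instance : Bicategory.Strict (FinAddCat.{w, v, u} k) where
  id_comp _ := rfl
  comp_id _ := rfl
  assoc _ _ _ := rfl
  leftUnitor_eqToIso _ := by ext; rfl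
  rightUnitor_eqToIso _ := by ext; rfl
  associator_eqToIso _ _ _ := by ext; rfl

end FinAddCat

/-! ### Finitary 2-categories -/

/-- A 2-category with `k`-linear categories of morphisms is finitary if it has finitely many
objects up to equivalence, its categories of morphisms are finitary, horizontal composition is
additive and `k`-linear in each variable, and identity 1-morphisms are indecomposable. -/
class IsFinitaryTwoCategory (k : Type w) [Field k] (C : Type u) [Bicategory.{w₁, v} C]
    [∀ i j : C, Preadditive (i ⟶ j)] [∀ i j : C, Linear k (i ⟶ j)] : Prop where
  strict : Bicategory.Strict C
  finite_objects : ∃ s : Set C, s.Finite ∧ ∀ i : C, ∃ j ∈ s, Nonempty (i ≌ j)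
  finitary_hom (i j : C) : IsFinitaryCategory k (i ⟶ j)
  whiskerLeft_add {a b c : C} (F : a ⟶ b) {G H : b ⟶ c} (α β : G ⟶ H) :
    F ◁ (α + β) = F ◁ α + F ◁ β
  whiskerLeft_smul {a b c : C} (F : a ⟶ b) {G H : b ⟶ c} (r : k) (α : G ⟶ H) :
    F ◁ (r • α) = r • (F ◁ α)
  add_whiskerRight {a b c : C} {F G : a ⟶ b} (α β : F ⟶ G) (H : b ⟶ c) :
    (α + β) ▷ H = α ▷ H + β ▷ H
  smul_whiskerRight {a b c : C} {F G : a ⟶ b} (r : k) (α : F ⟶ G) (H : b ⟶ c) :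
    (r • α) ▷ H = r • (α ▷ H)
  indecomposable_id (i : C) : IsIndecomposable (𝟙 i)

/-! ### The essential 2-subcategory -/

section Essential

variable {C : Type u} [Bicategory.{w, v} C]

/-- The relation `i ⪯ j`: there are `Φ ∈ C(j, i)` and `Ψ ∈ C(i, j)` with `Φ ∘ Ψ ≅ 𝟙 i`. -/
def RetractLE (i j : C) : Prop :=
  ∃ (Φ : j ⟶ i) (Ψ : i ⟶ j), Nonempty (Ψ ≫ Φ ≅ 𝟙 i)

/-- Maximality with respect to the preorder `⪯`. -/
def IsRetractMaximal (i : C) : Prop :=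
  ∀ j : C, RetractLE i j → RetractLE j i

/-- `D` is a choice of exactly one object in each equivalence class of maximal objects. -/
structure IsEssentialChoice (D : Set C) : Prop where
  maximal : ∀ i ∈ D, IsRetractMaximal i
  exists_equiv : ∀ i : C, IsRetractMaximal i → ∃ j ∈ D, Nonempty (i ≌ j)
  eq_of_equiv : ∀ i ∈ D, ∀ j ∈ D, Nonempty (i ≌ j) → i = j

/-- The full 2-subcategory on a set of objects. -/
abbrev FullSub (D : Set C) : Type u :=
  InducedBicategory C (Subtype.val : D → C)

/-- The inclusion of a full 2-subcategory. -/
abbrev FullSub.incl (D : Set C) : FullSub D ⥤ᵖ C :=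
  (InducedBicategory.forget (C := C) (F := (Subtype.val : D → C))).toPseudofunctor

instance FullSub.homPreadditive [∀ i j : C, Preadditive (i ⟶ j)] (D : Set C) (i j : FullSub D) :
    Preadditive (i ⟶ j) where
  homGroup F G := Equiv.addCommGroup (β := F.hom ⟶ G.hom)
    ⟨fun α => α.hom, fun α => ⟨α⟩, fun _ => rfl, fun _ => rfl⟩
  add_comp _ _ _ _ _ _ := InducedBicategory.hom₂_ext (Preadditive.add_comp _ _ _ _ _ _)
  comp_add _ _ _ _ _ _ := InducedBicategory.hom₂_ext (Preadditive.comp_add _ _ _ _ _ _)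

instance FullSub.homLinear (k : Type w₁) [Field k] [∀ i j : C, Preadditive (i ⟶ j)]
    [∀ i j : C, Linear k (i ⟶ j)] (D : Set C) (i j : FullSub D) : Linear k (i ⟶ j) where
  homModule F G :=
    let e : (F ⟶ G) ≃ (F.hom ⟶ G.hom) :=
      ⟨fun α => α.hom, fun α => ⟨α⟩, fun _ => rfl, fun _ => rfl⟩
    e.module k
  smul_comp _ _ _ _ _ _ := InducedBicategory.hom₂_ext (Linear.smul_comp (C := _ ⟶ _) _ _ _ _ _ _)
  comp_smul _ _ _ _ _ _ := InducedBicategory.hom₂_ext (Linear.comp_smul (C := _ ⟶ _) _ _ _ _ _ _)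

end Essential

/-! ### Biequivalences and precomposition -/

/-- A homomorphism is a biequivalence if it is essentially surjective on objects (up to
equivalence) and a local equivalence. -/
structure IsBiequivalence {A : Type u} [Bicategory.{w, v} A] {B : Type u₁} [Bicategory.{w₁, v₁} B]
    (H : A ⥤ᵖ B) : Prop where
  essSurj : ∀ b : B, ∃ a : A, Nonempty (H.obj a ≌ b)
  localEquiv : ∀ a a' : A, (H.mapFunctor a a').IsEquivalence

section Precomp

variable {D : Type u} [Bicategory.{w, v} D] {C : Type u₁} [Bicategory.{w₁, v₁} C]

variable {E : Type u₂} [Bicategory.{w₂, v₂} E]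

/-- Precomposition of a strong transformation with a homomorphism. -/
def precompTrans (J : D ⥤ᵖ C) {M N : C ⥤ᵖ E} (Λ : M ⟶ N) : J.comp M ⟶ J.comp N where
  app i := Λ.app (J.obj i)
  naturality F := Λ.naturality (J.map F)
  naturality_naturality α := Λ.naturality_naturality (J.map₂ α)
  naturality_id a := by
    change (Λ.naturality (J.map (𝟙 a))).hom ≫
        Λ.app (J.obj a) ◁ (N.map₂ (J.mapId a).hom ≫ (N.mapId (J.obj a)).hom) =
      (M.map₂ (J.mapId a).hom ≫ (M.mapId (J.obj a)).hom) ▷ Λ.app (J.obj a) ≫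
        (λ_ (Λ.app (J.obj a))).hom ≫ (ρ_ (Λ.app (J.obj a))).inv
    rw [Bicategory.whiskerLeft_comp, ← Λ.naturality_naturality_assoc, Λ.naturality_id,
      comp_whiskerRight, Category.assoc]
  naturality_comp {a b c} f g := by
    change (Λ.naturality (J.map (f ≫ g))).hom ≫ Λ.app (J.obj a) ◁
        (N.map₂ (J.mapComp f g).hom ≫ (N.mapComp (J.map f) (J.map g)).hom) =
      (M.map₂ (J.mapComp f g).hom ≫ (M.mapComp (J.map f) (J.map g)).hom) ▷ Λ.app (J.obj c) ≫
        (α_ _ _ _).hom ≫ M.map (J.map f) ◁ (Λ.naturality (J.map g)).hom ≫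
        (α_ _ _ _).inv ≫ (Λ.naturality (J.map f)).hom ▷ N.map (J.map g) ≫ (α_ _ _ _).hom
    rw [Bicategory.whiskerLeft_comp, ← Λ.naturality_naturality_assoc, Λ.naturality_comp,
      comp_whiskerRight, Category.assoc]

/-- Precomposition of a modification with a homomorphism. -/
def precompMod (J : D ⥤ᵖ C) {M N : C ⥤ᵖ E} {Λ Θ : M ⟶ N} (Γ : Λ ⟶ Θ) :
    precompTrans J Λ ⟶ precompTrans J Θ :=
  ⟨{ app := fun i => Γ.as.app (J.obj i)
     naturality := fun F => Γ.as.naturality (J.map F) }⟩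

/-- Precomposition is compatible with identity transformations. -/
def precompId (J : D ⥤ᵖ C) (M : C ⥤ᵖ E) : precompTrans J (𝟙 M) ≅ 𝟙 (J.comp M) :=
  Pseudofunctor.StrongTrans.isoMk (fun i => Iso.refl (𝟙 (M.obj (J.obj i)))) (by
    intro a b f
    change M.map (J.map f) ◁ 𝟙 (𝟙 (M.obj (J.obj b))) ≫
        (ρ_ (M.map (J.map f))).hom ≫ (λ_ (M.map (J.map f))).inv =
      ((ρ_ (M.map (J.map f))).hom ≫ (λ_ (M.map (J.map f))).inv) ≫
        𝟙 (𝟙 (M.obj (J.obj a))) ▷ M.map (J.map f)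
    simp)

/-- Precomposition is compatible with composition of transformations. -/
def precompComp (J : D ⥤ᵖ C) {M N P : C ⥤ᵖ E} (Λ : M ⟶ N) (Θ : N ⟶ P) :
    precompTrans J (Λ ≫ Θ) ≅ precompTrans J Λ ≫ precompTrans J Θ :=
  Pseudofunctor.StrongTrans.isoMk (fun i => Iso.refl (Λ.app (J.obj i) ≫ Θ.app (J.obj i))) (by
    intro a b f
    change M.map (J.map f) ◁ 𝟙 (Λ.app (J.obj b) ≫ Θ.app (J.obj b)) ≫
        ((Λ ≫ Θ).naturality (J.map f)).hom =
      ((Λ ≫ Θ).naturality (J.map f)).hom ≫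
        𝟙 (Λ.app (J.obj a) ≫ Θ.app (J.obj a)) ▷ P.map (J.map f)
    rw [Bicategory.whiskerLeft_id, id_whiskerRight]
    exact (Category.id_comp _).trans (Category.comp_id _).symm)

variable (E) in
/-- Precomposition with a homomorphism `J : D ⥤ᵖ C`, as a homomorphism between the 2-categories of
homomorphisms, strong transformations and modifications. -/
def precomp (J : D ⥤ᵖ C) : (C ⥤ᵖ E) ⥤ᵖ (D ⥤ᵖ E) where
  obj M := J.comp M
  map Λ := precompTrans J Λ
  map₂ Γ := precompMod J Γ
  map₂_id _ := rfl
  map₂_comp _ _ := rfl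
  mapId M := precompId J M
  mapComp Λ Θ := precompComp J Λ Θ
  map₂_whisker_left {M N P} Λ Θ Θ' Γ := by
    ext i
    change Λ.app (J.obj i) ◁ Γ.as.app (J.obj i) =
      𝟙 _ ≫ Λ.app (J.obj i) ◁ Γ.as.app (J.obj i) ≫ 𝟙 _
    simp
  map₂_whisker_right {M N P} Λ Λ' Γ Θ := by
    ext i
    change Γ.as.app (J.obj i) ▷ Θ.app (J.obj i) =
      𝟙 _ ≫ Γ.as.app (J.obj i) ▷ Θ.app (J.obj i) ≫ 𝟙 _
    simp
  map₂_associator Λ Θ Ξ := by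
    ext i
    change (α_ (Λ.app (J.obj i)) (Θ.app (J.obj i)) (Ξ.app (J.obj i))).hom =
      𝟙 _ ≫ 𝟙 (Λ.app (J.obj i) ≫ Θ.app (J.obj i)) ▷ Ξ.app (J.obj i) ≫
        (α_ (Λ.app (J.obj i)) (Θ.app (J.obj i)) (Ξ.app (J.obj i))).hom ≫
        Λ.app (J.obj i) ◁ 𝟙 (Θ.app (J.obj i) ≫ Ξ.app (J.obj i)) ≫ 𝟙 _
    simp
  map₂_left_unitor {M N} Λ := by
    ext i
    change (λ_ (Λ.app (J.obj i))).hom =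
      𝟙 _ ≫ 𝟙 (𝟙 (M.obj (J.obj i))) ▷ Λ.app (J.obj i) ≫ (λ_ (Λ.app (J.obj i))).hom
    simp
  map₂_right_unitor {M N} Λ := by
    ext i
    change (ρ_ (Λ.app (J.obj i))).hom =
      𝟙 _ ≫ Λ.app (J.obj i) ◁ 𝟙 (𝟙 (N.obj (J.obj i))) ≫ (ρ_ (Λ.app (J.obj i))).hom
    simp

end Precomp

/-- The restriction of a homomorphism to full 2-subcategories. -/
def restrictFull {A : Type u} [Bicategory.{w, v} A] {B : Type u₁} [Bicategory.{w₁, v₁} B]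
    (H : A ⥤ᵖ B) (P : Set A) (Q : Set B) (h : ∀ a ∈ P, H.obj a ∈ Q) :
    FullSub P ⥤ᵖ FullSub Q where
  obj a := (⟨H.obj a.1, h a.1 a.2⟩ : Q)
  map F := InducedBicategory.mkHom (H.map F.hom)
  map₂ α := ⟨H.map₂ α.hom⟩
  map₂_id F := InducedBicategory.hom₂_ext (H.map₂_id F.hom)
  map₂_comp α β := InducedBicategory.hom₂_ext (H.map₂_comp α.hom β.hom)
  mapId a := InducedBicategory.isoMk (H.mapId a.1)
  mapComp F G := InducedBicategory.isoMk (H.mapComp F.hom G.hom)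
  map₂_whisker_left F _ _ α := InducedBicategory.hom₂_ext (H.map₂_whisker_left F.hom α.hom)
  map₂_whisker_right α G := InducedBicategory.hom₂_ext (H.map₂_whisker_right α.hom G.hom)
  map₂_associator F G K := InducedBicategory.hom₂_ext (H.map₂_associator F.hom G.hom K.hom)
  map₂_left_unitor F := InducedBicategory.hom₂_ext (H.map₂_left_unitor F.hom)
  map₂_right_unitor F := InducedBicategory.hom₂_ext (H.map₂_right_unitor F.hom)

/-! ### 2-representations -/

/-- The 2-category `C`-afmod of finitary 2-representations of `C`: homomorphisms from `C` to
`𝔄ᶠ_k`, strong transformations and modifications. -/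
abbrev Afmod (k : Type w) [Field k] (C : Type u) [Bicategory.{w₁, v} C] :=
  C ⥤ᵖ FinAddCat.{w, v₂, u₂} k

/-- The locally `k`-linear finitary 2-representations: those for which all the functors
`C(i, j) → 𝔄ᶠ_k(M(i), M(j))` are additive and `k`-linear. -/
def linearReps (k : Type w) [Field k] (C : Type u) [Bicategory.{w₁, v} C]
    [∀ i j : C, Preadditive (i ⟶ j)] [∀ i j : C, Linear k (i ⟶ j)] :
    Set (Afmod.{w, w₁, v, v₂, u, u₂} k C) :=
  {M | ∀ i j : C, IsLinearFunctor k (i ⟶ j) (M.obj i ⟶ M.obj j) (M.mapFunctor i j)}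

/-- The 2-category of locally `k`-linear finitary 2-representations, a full 2-subcategory of
`C`-afmod. -/
abbrev LinearAfmod (k : Type w) [Field k] (C : Type u) [Bicategory.{w₁, v} C]
    [∀ i j : C, Preadditive (i ⟶ j)] [∀ i j : C, Linear k (i ⟶ j)] :=
  FullSub (linearReps.{w, w₁, v, v₂, u, u₂} k C)

/-- Restriction of 2-representations from `C` to a full 2-subcategory. -/
def res (k : Type w) [Field k] {C : Type u} [Bicategory.{w₁, v} C] (D : Set C) :
    Afmod.{w, w₁, v, v₂, u, u₂} k C ⥤ᵖ Afmod.{w, w₁, v, v₂, u, u₂} k (FullSub D) :=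
  precomp (FinAddCat.{w, v₂, u₂} k) (FullSub.incl D)

theorem res_mem_linearReps (k : Type w) [Field k] {C : Type u} [Bicategory.{w₁, v} C]
    [∀ i j : C, Preadditive (i ⟶ j)] [∀ i j : C, Linear k (i ⟶ j)] (D : Set C)
    (M : Afmod.{w, w₁, v, v₂, u, u₂} k C) (hM : M ∈ linearReps k C) :
    (res k D).obj M ∈ linearReps k (FullSub D) := by
  intro i j
  exact ⟨⟨fun {_ _ α β} => (hM i.1 j.1).1.map_add⟩,
    ⟨fun α r => (hM i.1 j.1).2.map_smul α.hom r⟩⟩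

/-- Restriction of locally `k`-linear 2-representations from `C` to a full 2-subcategory. -/
def linearRes (k : Type w) [Field k] {C : Type u} [Bicategory.{w₁, v} C]
    [∀ i j : C, Preadditive (i ⟶ j)] [∀ i j : C, Linear k (i ⟶ j)] (D : Set C) :
    LinearAfmod.{w, w₁, v, v₂, u, u₂} k C ⥤ᵖ LinearAfmod.{w, w₁, v, v₂, u, u₂} k (FullSub D) :=
  restrictFull (res k D) _ _ (res_mem_linearReps k D)

end FinitaryMorita

end

-- Every object `i` of `C` is a retract of an object `l` of `D`: there are `incl : i ⟶ l` and `proj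
-- : l ⟶ i` with `incl ≫ proj ≅ 𝟙 i`. Indeed `C` has finitely many objects up to equivalence, so
-- each object lies below a maximal one, and `D` meets every equivalence class of maximal objects
-- (`nonempty_retractData`). Nothing else about `D` is used.
--
-- The inverse of restriction is a bicategorical right Kan extension. For a 2-representation `M` of
-- the full 2-subcategory on `D`, its extension takes at `i` the category `Family M i` of
-- transformations from `C(i, -)`, restricted to `D`, to `M`; a 1-morphism `F : i ⟶ j` acts by
-- precomposing the index with `F`. Evaluation at `incl`, followed by the family generated along
-- `proj`, is isomorphic to the identity (`Family.alongEvalIso`), so `Family M i` is a retract of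
-- the finitary category `M(l)`. A retract of a finitary category is finitary
-- (`IsFinitaryCategory.of_retract`).
--
-- The Yoneda argument gives `M(l) ≃ Family M l` for `l` in `D`, so the extension restricts to `M`
-- up to equivalence. The same retraction shows that for a 2-representation `N` of all of `C` the
-- functor `N(i) ⥤ Family (N|D) i`, `X ↦ (N(G) X)_G`, is an equivalence at every `i`
-- (`Family.isEquivalence_restrictedYoneda_app`). Through these equivalences transformations and
-- modifications given on `D` extend to `C`, the latter uniquely; this is the local equivalence.
--
-- Families live in larger universes than the values of `M`. All coherence is therefore handled for
-- category-valued homomorphisms `CatRep` with unrestricted universes; at the end each `Family M i`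
-- is replaced by an equivalent finitary category in the right universes, and the structure is
-- transported along the equivalences. Local linearity passes to the extension because the
-- retraction expresses the action of 2-morphisms on a family through `M` and left whiskering.

universe a₁ a₂ a₃ b₁ b₂ b₃

noncomputable section

namespace FinitaryMorita

/-! ### Category-valued homomorphisms, componentwise -/

section CatValued

variable {C : Type u} [Bicategory.{w, v} C] {ι : Type u₁}

/-- A category-valued homomorphism, with values `S i`, on the full sub-bicategory of `C` on the
objects `J i`. All coherence data are given objectwise, and there is no relation between
universes. -/
structure CatRep (J : ι → C) (S : ι → Type a₁) [∀ i, Category.{b₁} (S i)] where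
  map {i j : ι} (F : J i ⟶ J j) : S i ⥤ S j
  map₂ {i j : ι} {F G : J i ⟶ J j} (α : F ⟶ G) (X : S i) : (map F).obj X ⟶ (map G).obj X
  mapId (i : ι) (X : S i) : (map (𝟙 (J i))).obj X ≅ X
  mapComp {i j l : ι} (F : J i ⟶ J j) (G : J j ⟶ J l) (X : S i) :
    (map (F ≫ G)).obj X ≅ (map G).obj ((map F).obj X)
  map₂_naturality {i j : ι} {F G : J i ⟶ J j} (α : F ⟶ G) {X Y : S i} (f : X ⟶ Y) :
    (map F).map f ≫ map₂ α Y = map₂ α X ≫ (map G).map f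
  map₂_id {i j : ι} (F : J i ⟶ J j) (X : S i) : map₂ (𝟙 F) X = 𝟙 _
  map₂_comp {i j : ι} {F G H : J i ⟶ J j} (α : F ⟶ G) (β : G ⟶ H) (X : S i) :
    map₂ (α ≫ β) X = map₂ α X ≫ map₂ β X
  mapId_naturality {i : ι} {X Y : S i} (f : X ⟶ Y) :
    (map (𝟙 (J i))).map f ≫ (mapId i Y).hom = (mapId i X).hom ≫ f
  mapComp_naturality {i j l : ι} (F : J i ⟶ J j) (G : J j ⟶ J l) {X Y : S i} (f : X ⟶ Y) :
    (map (F ≫ G)).map f ≫ (mapComp F G Y).hom =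
      (mapComp F G X).hom ≫ (map G).map ((map F).map f)
  map₂_whiskerLeft {i j l : ι} (F : J i ⟶ J j) {G G' : J j ⟶ J l} (β : G ⟶ G') (X : S i) :
    map₂ (F ◁ β) X ≫ (mapComp F G' X).hom = (mapComp F G X).hom ≫ map₂ β ((map F).obj X)
  map₂_whiskerRight {i j l : ι} {F F' : J i ⟶ J j} (α : F ⟶ F') (G : J j ⟶ J l) (X : S i) :
    map₂ (α ▷ G) X ≫ (mapComp F' G X).hom = (mapComp F G X).hom ≫ (map G).map (map₂ α X)
  map₂_associator {i j l m : ι} (F : J i ⟶ J j) (G : J j ⟶ J l) (H : J l ⟶ J m) (X : S i) :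
    map₂ (α_ F G H).hom X ≫ (mapComp F (G ≫ H) X).hom ≫ (mapComp G H ((map F).obj X)).hom =
      (mapComp (F ≫ G) H X).hom ≫ (map H).map (mapComp F G X).hom
  map₂_leftUnitor {i j : ι} (F : J i ⟶ J j) (X : S i) :
    map₂ (λ_ F).hom X = (mapComp (𝟙 (J i)) F X).hom ≫ (map F).map (mapId i X).hom
  map₂_rightUnitor {i j : ι} (F : J i ⟶ J j) (X : S i) :
    map₂ (ρ_ F).hom X = (mapComp F (𝟙 (J j)) X).hom ≫ (mapId j ((map F).obj X)).hom

variable {J : ι → C} {S : ι → Type a₁} [∀ i, Category.{b₁} (S i)]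
  {T : ι → Type a₂} [∀ i, Category.{b₂} (T i)] {U : ι → Type a₃} [∀ i, Category.{b₃} (U i)]

/-- A strong transformation of category-valued homomorphisms, componentwise. -/
structure CatTrans (M : CatRep J S) (N : CatRep J T) where
  app (i : ι) : S i ⥤ T i
  nat {i j : ι} (F : J i ⟶ J j) (X : S i) :
    (app j).obj ((M.map F).obj X) ≅ (N.map F).obj ((app i).obj X)
  nat_naturality {i j : ι} (F : J i ⟶ J j) {X Y : S i} (f : X ⟶ Y) :
    (app j).map ((M.map F).map f) ≫ (nat F Y).hom = (nat F X).hom ≫ (N.map F).map ((app i).map f)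
  nat_map₂ {i j : ι} {F G : J i ⟶ J j} (α : F ⟶ G) (X : S i) :
    (app j).map (M.map₂ α X) ≫ (nat G X).hom = (nat F X).hom ≫ N.map₂ α ((app i).obj X)
  nat_id (i : ι) (X : S i) :
    (nat (𝟙 (J i)) X).hom ≫ (N.mapId i ((app i).obj X)).hom = (app i).map (M.mapId i X).hom
  nat_comp {i j l : ι} (F : J i ⟶ J j) (G : J j ⟶ J l) (X : S i) :
    (nat (F ≫ G) X).hom ≫ (N.mapComp F G ((app i).obj X)).hom =
      (app l).map (M.mapComp F G X).hom ≫ (nat G ((M.map F).obj X)).hom ≫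
        (N.map G).map (nat F X).hom

/-- A modification of strong transformations, componentwise. -/
structure CatMod {M : CatRep J S} {N : CatRep J T} (Λ Θ : CatTrans M N) where
  app (i : ι) (X : S i) : (Λ.app i).obj X ⟶ (Θ.app i).obj X
  naturality {i : ι} {X Y : S i} (f : X ⟶ Y) :
    (Λ.app i).map f ≫ app i Y = app i X ≫ (Θ.app i).map f
  app_map {i j : ι} (F : J i ⟶ J j) (X : S i) :
    app j ((M.map F).obj X) ≫ (Θ.nat F X).hom = (Λ.nat F X).hom ≫ (N.map F).map (app i X)

/-- Composition of strong transformations. -/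
@[simps]
def CatTrans.comp {M : CatRep J S} {N : CatRep J T} {P : CatRep J U} (Λ : CatTrans M N)
    (Θ : CatTrans N P) : CatTrans M P where
  app i := Λ.app i ⋙ Θ.app i
  nat {i j} F X := (Θ.app j).mapIso (Λ.nat F X) ≪≫ Θ.nat F ((Λ.app i).obj X)
  nat_naturality F X Y f := by
    simp only [Functor.comp_map, Functor.comp_obj, Iso.trans_hom, Functor.mapIso_hom,
      Category.assoc, ← Θ.nat_naturality, ← Functor.map_comp_assoc, Λ.nat_naturality]
  nat_map₂ α X := by
    simp only [Functor.comp_map, Functor.comp_obj, Iso.trans_hom, Functor.mapIso_hom,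
      Category.assoc, ← Θ.nat_map₂, ← Functor.map_comp_assoc, Λ.nat_map₂]
  nat_id i X := by
    simp only [Functor.comp_map, Functor.comp_obj, Iso.trans_hom, Functor.mapIso_hom,
      Category.assoc, Θ.nat_id, ← Functor.map_comp, Λ.nat_id]
  nat_comp F G X := by
    simp only [Functor.comp_map, Functor.comp_obj, Iso.trans_hom, Functor.mapIso_hom,
      Category.assoc, Θ.nat_comp, Functor.map_comp]
    rw [← Functor.map_comp_assoc, Λ.nat_comp]
    simp only [Functor.map_comp, Category.assoc]
    rw [reassoc_of% Θ.nat_naturality]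

/-- An inverse up to isomorphism of a functor, as an adjoint equivalence with objectwise data. -/
structure AdjInverse {𝒜 : Type a₁} [Category.{b₁} 𝒜] {ℬ : Type a₂} [Category.{b₂} ℬ]
    (e : 𝒜 ⥤ ℬ) where
  inv : ℬ ⥤ 𝒜
  unit (X : 𝒜) : X ≅ inv.obj (e.obj X)
  counit (Y : ℬ) : e.obj (inv.obj Y) ≅ Y
  unit_naturality {X Y : 𝒜} (f : X ⟶ Y) : f ≫ (unit Y).hom = (unit X).hom ≫ inv.map (e.map f)
  counit_naturality {X Y : ℬ} (f : X ⟶ Y) :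
    e.map (inv.map f) ≫ (counit Y).hom = (counit X).hom ≫ f
  left_triangle (X : 𝒜) : e.map (unit X).hom ≫ (counit (e.obj X)).hom = 𝟙 _
  right_triangle (Y : ℬ) : (unit (inv.obj Y)).hom ≫ inv.map (counit Y).hom = 𝟙 _

namespace AdjInverse

variable {𝒜 : Type a₁} [Category.{b₁} 𝒜] {ℬ : Type a₂} [Category.{b₂} ℬ]

/-- The adjoint inverse of a functor that is an equivalence. -/
def ofIsEquivalence (e : 𝒜 ⥤ ℬ) [e.IsEquivalence] : AdjInverse e where
  inv := e.inv
  unit X := e.asEquivalence.unitIso.app X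
  counit Y := e.asEquivalence.counitIso.app Y
  unit_naturality f := e.asEquivalence.unitIso.hom.naturality f
  counit_naturality f := e.asEquivalence.counitIso.hom.naturality f
  left_triangle X := e.asEquivalence.functor_unit_comp X
  right_triangle Y := e.asEquivalence.unit_inverse_comp Y

variable {e : 𝒜 ⥤ ℬ} (q : AdjInverse e)

theorem counit_inv_naturality {X Y : ℬ} (f : X ⟶ Y) :
    f ≫ (q.counit Y).inv = (q.counit X).inv ≫ e.map (q.inv.map f) := by
  rw [Iso.comp_inv_eq, Category.assoc, q.counit_naturality, Iso.inv_hom_id_assoc]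

theorem unit_inv_naturality {X Y : 𝒜} (f : X ⟶ Y) :
    q.inv.map (e.map f) ≫ (q.unit Y).inv = (q.unit X).inv ≫ f := by
  rw [Iso.comp_inv_eq, Category.assoc, q.unit_naturality, Iso.inv_hom_id_assoc]

/-- By the first triangle identity the image of the unit is inverse to the counit. This and its
companion for the second triangle cancel units against counits in all the transport computations. -/
theorem map_unit_inv (X : 𝒜) : e.map (q.unit X).inv = (q.counit (e.obj X)).hom := by
  rw [← cancel_epi (e.map (q.unit X).hom), q.left_triangle, ← e.map_comp]; simp

theorem map_counit_inv (Y : ℬ) : q.inv.map (q.counit Y).inv = (q.unit (q.inv.obj Y)).hom := by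
  rw [← cancel_mono (q.inv.map (q.counit Y).hom), q.right_triangle, ← q.inv.map_comp]; simp

end AdjInverse

/-- Transport of a category-valued homomorphism along objectwise equivalences. -/
def CatRep.transport (N : CatRep J T) {e : ∀ i, S i ⥤ T i} (q : ∀ i, AdjInverse (e i)) :
    CatRep J S where
  map {i j} F :=
    { obj := fun X => (q j).inv.obj ((N.map F).obj ((e i).obj X))
      map := fun f => (q j).inv.map ((N.map F).map ((e i).map f)) }
  map₂ {i j} F G α X := (q j).inv.map (N.map₂ α ((e i).obj X))
  mapId i X := (q i).inv.mapIso (N.mapId i ((e i).obj X)) ≪≫ ((q i).unit X).symm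
  -- Composing the transported functors creates `(q j).inv` followed by `e j` in the middle; the
  -- inverse counit inserts this pair.
  mapComp {i j l} F G X := (q l).inv.mapIso (N.mapComp F G ((e i).obj X) ≪≫
    (N.map G).mapIso ((q j).counit ((N.map F).obj ((e i).obj X))).symm)
  map₂_naturality {i j} F G α X Y f := by
    simp only [← Functor.map_comp, N.map₂_naturality]
  map₂_id F X := by simp only [N.map₂_id, CategoryTheory.Functor.map_id]
  map₂_comp α β X := by simp only [N.map₂_comp, Functor.map_comp]
  mapId_naturality {i X Y} f := by
    simp only [Iso.trans_hom, Functor.mapIso_hom, Iso.symm_hom, Category.assoc,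
      ← (q i).unit_inv_naturality, ← Functor.map_comp_assoc, N.mapId_naturality]
  mapComp_naturality {i j l} F G X Y f := by
    simp only [Functor.mapIso_hom, Iso.trans_hom, Iso.symm_hom, ← Functor.map_comp,
      Category.assoc, reassoc_of% N.mapComp_naturality, (q j).counit_inv_naturality]
  map₂_whiskerLeft {i j l} F G G' β X := by
    simp only [Functor.mapIso_hom, Iso.trans_hom, Iso.symm_hom, ← Functor.map_comp,
      Category.assoc, reassoc_of% N.map₂_whiskerLeft, N.map₂_naturality]
  map₂_whiskerRight {i j l} F F' α G X := by
    simp only [Functor.mapIso_hom, Iso.trans_hom, Iso.symm_hom, ← Functor.map_comp,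
      Category.assoc, reassoc_of% N.map₂_whiskerRight, (q j).counit_inv_naturality]
  map₂_associator {i j l m} F G H X := by
    simp only [Functor.mapIso_hom, Iso.trans_hom, Iso.symm_hom, ← Functor.map_comp,
      Category.assoc]
    congr 1
    rw [reassoc_of% N.mapComp_naturality, reassoc_of% N.map₂_associator]
    simp only [← Functor.map_comp, ← (q l).counit_inv_naturality, Category.assoc]
  map₂_leftUnitor {i j} F X := by
    simp only [Functor.mapIso_hom, Iso.trans_hom, Iso.symm_hom, ← Functor.map_comp,
      Category.assoc, N.map₂_leftUnitor]
    rw [Functor.map_comp (e i), (q i).map_unit_inv, (q i).counit_naturality,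
      Iso.inv_hom_id_assoc]
  map₂_rightUnitor {i j} F X := by
    simp only [Functor.mapIso_hom, Iso.trans_hom, Iso.symm_hom, ← Functor.map_comp_assoc,
      Category.assoc, N.map₂_rightUnitor, N.mapId_naturality]
    simp only [Functor.map_comp, (q j).map_counit_inv, Category.assoc, Iso.hom_inv_id,
      Category.comp_id]

/-- The objectwise equivalences along which a homomorphism is transported are the components of a
strong transformation. -/
def CatRep.transportTrans (N : CatRep J T) {e : ∀ i, S i ⥤ T i} (q : ∀ i, AdjInverse (e i)) :
    CatTrans (N.transport q) N where
  app := e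
  nat {i j} F X := (q j).counit ((N.map F).obj ((e i).obj X))
  nat_naturality {i j} F X Y f := (q j).counit_naturality _
  nat_map₂ {i j} F G α X := (q j).counit_naturality _
  nat_id i X := by
    simp only [CatRep.transport, Iso.trans_hom, Functor.mapIso_hom, Iso.symm_hom,
      Functor.map_comp, (q i).map_unit_inv, (q i).counit_naturality]
  nat_comp {i j l} F G X := by
    simp only [CatRep.transport, Iso.trans_hom, Functor.mapIso_hom, Iso.symm_hom]
    rw [reassoc_of% (q l).counit_naturality, Category.assoc, ← Functor.map_comp, Iso.inv_hom_id,
      CategoryTheory.Functor.map_id, Category.comp_id]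

/-! ### Inverting strong transformations whose components are equivalences. -/

namespace CatTrans

variable {M : CatRep J S} {N : CatRep J T} (Λ : CatTrans M N)

theorem nat_inv_naturality {i j : ι} (F : J i ⟶ J j) {X Y : S i} (f : X ⟶ Y) :
    (N.map F).map ((Λ.app i).map f) ≫ (Λ.nat F Y).inv =
      (Λ.nat F X).inv ≫ (Λ.app j).map ((M.map F).map f) := by
  rw [Iso.comp_inv_eq, Category.assoc, Λ.nat_naturality, Iso.inv_hom_id_assoc]

theorem nat_inv_map₂ {i j : ι} {F G : J i ⟶ J j} (α : F ⟶ G) (X : S i) :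
    N.map₂ α ((Λ.app i).obj X) ≫ (Λ.nat G X).inv =
      (Λ.nat F X).inv ≫ (Λ.app j).map (M.map₂ α X) := by
  rw [Iso.comp_inv_eq, Category.assoc, Λ.nat_map₂, Iso.inv_hom_id_assoc]

theorem nat_inv_comp {i j l : ι} (F : J i ⟶ J j) (G : J j ⟶ J l) (X : S i) :
    (Λ.nat (F ≫ G) X).inv ≫ (Λ.app l).map (M.mapComp F G X).hom =
      (N.mapComp F G ((Λ.app i).obj X)).hom ≫ (N.map G).map (Λ.nat F X).inv ≫
        (Λ.nat G ((M.map F).obj X)).inv := by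
  rw [Iso.inv_comp_eq, reassoc_of% Λ.nat_comp, ← Functor.map_comp_assoc, Iso.hom_inv_id,
    CategoryTheory.Functor.map_id, Category.id_comp, Iso.hom_inv_id, Category.comp_id]

/-- The inverse of a strong transformation whose components are equivalences. -/
@[simps]
def inverse (q : ∀ i, AdjInverse (Λ.app i)) : CatTrans N M where
  app i := (q i).inv
  -- The mate of the inverse of `Λ.nat`: insert the counit at `i`, cross with `(Λ.nat F _).symm`,
  -- and remove the unit at `j`.
  nat {i j} F X := (q j).inv.mapIso ((N.map F).mapIso ((q i).counit X).symm ≪≫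
    (Λ.nat F ((q i).inv.obj X)).symm) ≪≫ ((q j).unit _).symm
  nat_naturality {i j} F X Y f := by
    simp only [Iso.trans_hom, Functor.mapIso_hom, Iso.symm_hom, Category.assoc]
    rw [← (q j).unit_inv_naturality]
    simp only [← Functor.map_comp_assoc, Category.assoc, ← Λ.nat_inv_naturality,
      (q i).counit_inv_naturality]
  nat_map₂ {i j} F G α X := by
    simp only [Iso.trans_hom, Functor.mapIso_hom, Iso.symm_hom, Category.assoc]
    rw [← (q j).unit_inv_naturality]
    simp only [← Functor.map_comp_assoc, Category.assoc, ← Λ.nat_inv_map₂,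
      ← reassoc_of% N.map₂_naturality]
  nat_id i X := by
    simp only [Iso.trans_hom, Functor.mapIso_hom, Iso.symm_hom, Category.assoc]
    rw [← (q i).unit_inv_naturality, ← Λ.nat_id, ← Functor.map_comp_assoc]
    simp only [Category.assoc, Iso.inv_hom_id_assoc, N.mapId_naturality]
    simp only [Functor.map_comp, (q i).map_counit_inv, Category.assoc, Iso.hom_inv_id,
      Category.comp_id]
  nat_comp {i j l} F G X := by
    simp only [Iso.trans_hom, Functor.mapIso_hom, Iso.symm_hom, Category.assoc]
    rw [← (q l).unit_inv_naturality, ← (q l).unit_inv_naturality]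
    simp only [← Functor.map_comp_assoc, Category.assoc, Λ.nat_inv_comp, ← Λ.nat_inv_naturality,
      reassoc_of% N.mapComp_naturality]
    rw [Functor.map_comp (Λ.app j), (q j).map_unit_inv, (q j).counit_naturality,
      Iso.inv_hom_id_assoc, Functor.map_comp, Category.assoc]

end CatTrans

end CatValued

/-! ### Compatible families -/

section Families

variable {C : Type u} [Bicategory.{w, v} C] {ι : Type u₁} {J : ι → C}
  {S : ι → Type a₁} [∀ i, Category.{b₁} (S i)] {T : ι → Type a₂} [∀ i, Category.{b₂} (T i)]

/-- A compatible family of objects of a homomorphism `M` indexed by the 1-morphisms out of `i`: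
a strong transformation from `C(i, -)` to `M`, without the unit constraint. -/
structure Family (M : CatRep J S) (i : C) where
  obj {l : ι} (G : i ⟶ J l) : S l
  map {l : ι} {G G' : i ⟶ J l} (α : G ⟶ G') : obj G ⟶ obj G'
  act {l m : ι} (G : i ⟶ J l) (H : J l ⟶ J m) : (M.map H).obj (obj G) ≅ obj (G ≫ H)
  map_id {l : ι} (G : i ⟶ J l) : map (𝟙 G) = 𝟙 _
  map_comp {l : ι} {G G' G'' : i ⟶ J l} (α : G ⟶ G') (β : G' ⟶ G'') :
    map (α ≫ β) = map α ≫ map β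
  act_left {l m : ι} {G G' : i ⟶ J l} (α : G ⟶ G') (H : J l ⟶ J m) :
    (M.map H).map (map α) ≫ (act G' H).hom = (act G H).hom ≫ map (α ▷ H)
  act_right {l m : ι} (G : i ⟶ J l) {H H' : J l ⟶ J m} (β : H ⟶ H') :
    M.map₂ β (obj G) ≫ (act G H').hom = (act G H).hom ≫ map (G ◁ β)
  act_comp {l m n : ι} (G : i ⟶ J l) (H : J l ⟶ J m) (K : J m ⟶ J n) :
    (act G (H ≫ K)).hom = (M.mapComp H K (obj G)).hom ≫ (M.map K).map (act G H).hom ≫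
      (act (G ≫ H) K).hom ≫ map (α_ G H K).hom

namespace Family

variable {M : CatRep J S} {N : CatRep J T} {i : C}

/-- The isomorphism between members of a family given by a 2-isomorphism. -/
@[simps]
def mapIso (A : Family M i) {l : ι} {G G' : i ⟶ J l} (α : G ≅ G') : A.obj G ≅ A.obj G' where
  hom := A.map α.hom
  inv := A.map α.inv
  hom_inv_id := by rw [← A.map_comp, α.hom_inv_id, A.map_id]
  inv_hom_id := by rw [← A.map_comp, α.inv_hom_id, A.map_id]

/-- Together with `map_square`, this turns identities between 2-morphisms of `C` into identities in
a family. Most axioms of `rep` thereby reduce to coherence in `C`. -/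
theorem map_triangle (A : Family M i) {l : ι} {F G H : i ⟶ J l} {a : F ⟶ H} {b : F ⟶ G}
    {c : G ⟶ H} (h : a = b ≫ c) : A.map a = A.map b ≫ A.map c := by
  rw [h, A.map_comp]

theorem map_square (A : Family M i) {l : ι} {F G G' H : i ⟶ J l} {a : F ⟶ G} {b : G ⟶ H}
    {c : F ⟶ G'} {d : G' ⟶ H} (h : a ≫ b = c ≫ d) : A.map a ≫ A.map b = A.map c ≫ A.map d := by
  rw [← A.map_comp, h, A.map_comp]

/-- Morphisms of compatible families. -/
@[ext]
structure Hom (A B : Family M i) where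
  app {l : ι} (G : i ⟶ J l) : A.obj G ⟶ B.obj G
  map_app {l : ι} {G G' : i ⟶ J l} (α : G ⟶ G') : A.map α ≫ app G' = app G ≫ B.map α
  act_app {l m : ι} (G : i ⟶ J l) (H : J l ⟶ J m) :
    (A.act G H).hom ≫ app (G ≫ H) = (M.map H).map (app G) ≫ (B.act G H).hom

instance category : Category (Family M i) where
  Hom := Hom
  id A :=
    { app G := 𝟙 (A.obj G)
      map_app α := by simp
      act_app G H := by simp }
  comp f g :=
    { app G := f.app G ≫ g.app G
      map_app α := by rw [reassoc_of% f.map_app, g.map_app, Category.assoc]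
      act_app G H := by
        rw [reassoc_of% f.act_app, g.act_app, Functor.map_comp, Category.assoc] }

@[ext]
theorem hom_ext {A B : Family M i} {f g : A ⟶ B}
    (h : ∀ (l : ι) (G : i ⟶ J l), f.app G = g.app G) : f = g :=
  Hom.ext (funext fun l => funext fun G => h l G)

theorem congr_app {A B : Family M i} {f g : A ⟶ B} (h : f = g) {l : ι} (G : i ⟶ J l) :
    f.app G = g.app G := by
  rw [h]

@[simp]
theorem id_app (A : Family M i) {l : ι} (G : i ⟶ J l) : Hom.app (𝟙 A) G = 𝟙 (A.obj G) := rfl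

@[simp]
theorem comp_app {A B D : Family M i} (f : A ⟶ B) (g : B ⟶ D) {l : ι} (G : i ⟶ J l) :
    (f ≫ g).app G = f.app G ≫ g.app G := rfl

/-- An isomorphism of families from its members. -/
@[simps]
def isoMk {A B : Family M i} (f : ∀ {l : ι} (G : i ⟶ J l), A.obj G ≅ B.obj G)
    (hmap : ∀ {l : ι} {G G' : i ⟶ J l} (α : G ⟶ G'),
      A.map α ≫ (f G').hom = (f G).hom ≫ B.map α)
    (hact : ∀ {l m : ι} (G : i ⟶ J l) (H : J l ⟶ J m),
      (A.act G H).hom ≫ (f (G ≫ H)).hom = (M.map H).map (f G).hom ≫ (B.act G H).hom) :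
    A ≅ B where
  hom := { app G := (f G).hom, map_app := hmap, act_app := hact }
  inv :=
    { app G := (f G).inv
      map_app α := by rw [Iso.comp_inv_eq, Category.assoc, hmap, Iso.inv_hom_id_assoc]
      act_app G H := by
        rw [Iso.comp_inv_eq, Category.assoc, hact, ← Functor.map_comp_assoc, Iso.inv_hom_id,
          CategoryTheory.Functor.map_id, Category.id_comp] }
  hom_inv_id := by ext; simp
  inv_hom_id := by ext; simp

/-- Evaluation of families at a 1-morphism. -/
@[simps]
def eval (M : CatRep J S) {l : ι} (G : i ⟶ J l) : Family M i ⥤ S l where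
  obj A := A.obj G
  map f := f.app G

/-- The pullback of a family along a 1-morphism. -/
@[simps]
def pull {j : C} (A : Family M i) (F : i ⟶ j) : Family M j where
  obj G := A.obj (F ≫ G)
  map α := A.map (F ◁ α)
  act G H := A.act (F ≫ G) H ≪≫ A.mapIso (α_ F G H)
  map_id G := by rw [Bicategory.whiskerLeft_id, A.map_id]
  map_comp α β := by rw [Bicategory.whiskerLeft_comp, A.map_comp]
  act_left α H := by
    simp only [Iso.trans_hom, mapIso_hom, Category.assoc, reassoc_of% A.act_left, ← A.map_comp]
    simp
  act_right G H H' β := by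
    simp only [Iso.trans_hom, mapIso_hom, Category.assoc, reassoc_of% A.act_right, ← A.map_comp]
    simp
  act_comp G H K := by
    simp only [Iso.trans_hom, mapIso_hom, Category.assoc, A.act_comp (F ≫ G), Functor.map_comp,
      reassoc_of% A.act_left, ← A.map_comp]
    simp

/-- The homomorphism of compatible families, on the whole of `C`. -/
def rep (M : CatRep J S) : CatRep (fun i : C => i) (Family M) where
  map F :=
    { obj := fun A => A.pull F
      map := fun f =>
        { app := fun G => f.app (F ≫ G)
          map_app := fun α => f.map_app _
          act_app := fun G H => by
            simp only [pull, Iso.trans_hom, mapIso_hom, Category.assoc, f.map_app,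
              reassoc_of% f.act_app] } }
  map₂ {i j F F'} α A :=
    { app := fun G => A.map (α ▷ G)
      map_app := fun β => A.map_square (whisker_exchange _ _)
      act_app := fun G H => by
        simp only [pull, Iso.trans_hom, mapIso_hom, Category.assoc, reassoc_of% A.act_left,
          ← A.map_comp]
        simp }
  mapId i A := isoMk (fun G => A.mapIso (λ_ G))
    (fun α => A.map_square (leftUnitor_naturality α))
    (fun G H => by
      simp only [pull, Iso.trans_hom, mapIso_hom, Category.assoc, A.act_left, ← A.map_comp]
      simp)
  mapComp F G A := isoMk (fun K => A.mapIso (α_ F G K))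
    (fun α => A.map_square (by simp))
    (fun K H => by
      simp only [pull, Iso.trans_hom, mapIso_hom, Category.assoc, reassoc_of% A.act_left,
        ← A.map_comp]
      simp)
  map₂_naturality α X Y f := by ext l G; exact (f.map_app _).symm
  map₂_id F A := by ext l G; exact (congrArg A.map (id_whiskerRight F G)).trans (A.map_id _)
  map₂_comp α β A := by ext l G; exact A.map_triangle (comp_whiskerRight α β G)
  mapId_naturality f := by ext l G; exact (f.map_app _).symm
  mapComp_naturality F G X Y f := by ext l K; exact (f.map_app _).symm
  map₂_whiskerLeft F G G' β A := by ext l K; exact A.map_square (by simp)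
  map₂_whiskerRight α G A := by ext l K; exact A.map_square (by simp)
  map₂_associator F G H A := by
    ext l K
    exact (congrArg (A.map ((α_ F G H).hom ▷ K) ≫ ·) (A.map_comp _ _).symm).trans
      (A.map_square (pentagon F G H K))
  map₂_leftUnitor F A := by ext l K; exact A.map_triangle (by simp)
  map₂_rightUnitor F A := by ext l K; exact A.map_triangle (by simp)

end Family

/-- Restriction of a homomorphism on `C` to a full sub-bicategory. -/
@[simps]
def CatRep.restrict {T : C → Type a₂} [∀ i, Category.{b₂} (T i)] (N : CatRep (fun i : C => i) T)
    (J : ι → C) : CatRep J (fun l => T (J l)) where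
  map F := N.map F
  map₂ α X := N.map₂ α X
  mapId l X := N.mapId (J l) X
  mapComp F G X := N.mapComp F G X
  map₂_naturality α _ _ f := N.map₂_naturality α f
  map₂_id F X := N.map₂_id F X
  map₂_comp α β X := N.map₂_comp α β X
  mapId_naturality f := N.mapId_naturality f
  mapComp_naturality F G _ _ f := N.mapComp_naturality F G f
  map₂_whiskerLeft F _ _ β X := N.map₂_whiskerLeft F β X
  map₂_whiskerRight α G X := N.map₂_whiskerRight α G X
  map₂_associator F G H X := N.map₂_associator F G H X
  map₂_leftUnitor F X := N.map₂_leftUnitor F X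
  map₂_rightUnitor F X := N.map₂_rightUnitor F X

/-- Restriction of a strong transformation to a full sub-bicategory. -/
@[simps]
def CatTrans.restrict {T : C → Type a₂} [∀ i, Category.{b₂} (T i)] {U : C → Type a₃}
    [∀ i, Category.{b₃} (U i)] {M : CatRep (fun i : C => i) T} {N : CatRep (fun i : C => i) U}
    (Λ : CatTrans M N) (J : ι → C) : CatTrans (M.restrict J) (N.restrict J) where
  app l := Λ.app (J l)
  nat F X := Λ.nat F X
  nat_naturality F _ _ f := Λ.nat_naturality F f
  nat_map₂ α X := Λ.nat_map₂ α X
  nat_id l X := Λ.nat_id (J l) X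
  nat_comp F G X := Λ.nat_comp F G X

/-- The value of a homomorphism on a 2-isomorphism. -/
@[simps]
def CatRep.map₂Iso (M : CatRep J S) {i j : ι} {F G : J i ⟶ J j} (α : F ≅ G) (X : S i) :
    (M.map F).obj X ≅ (M.map G).obj X where
  hom := M.map₂ α.hom X
  inv := M.map₂ α.inv X
  hom_inv_id := by rw [← M.map₂_comp, α.hom_inv_id, M.map₂_id]
  inv_hom_id := by rw [← M.map₂_comp, α.inv_hom_id, M.map₂_id]

/-- The associativity axiom solved for an inverse, in exactly the form of `act_comp` for the family
of images of an object. -/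
theorem CatRep.mapComp_inv_assoc (M : CatRep J S) {i j l m : ι} (F : J i ⟶ J j) (G : J j ⟶ J l)
    (H : J l ⟶ J m) (X : S i) :
    (M.mapComp F (G ≫ H) X).inv = (M.mapComp G H ((M.map F).obj X)).hom ≫
      (M.map H).map (M.mapComp F G X).inv ≫ (M.mapComp (F ≫ G) H X).inv ≫
        M.map₂ (α_ F G H).hom X := by
  rw [← cancel_epi (M.map₂Iso (α_ F G H) X ≪≫ M.mapComp F (G ≫ H) X).hom]
  simp only [Iso.trans_hom, CatRep.map₂Iso_hom, Category.assoc, Iso.hom_inv_id, Category.comp_id,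
    reassoc_of% M.map₂_associator]
  rw [← Functor.map_comp_assoc, Iso.hom_inv_id, CategoryTheory.Functor.map_id, Category.id_comp,
    Iso.hom_inv_id_assoc]

/-! ### Yoneda transformations and functoriality of families. -/

namespace Family

/-- The family of all images of an object. -/
@[simps]
def ofObj (M : CatRep J S) {l : ι} (X : S l) : Family M (J l) where
  obj G := (M.map G).obj X
  map α := M.map₂ α X
  act G H := (M.mapComp G H X).symm
  map_id G := M.map₂_id G X
  map_comp α β := M.map₂_comp α β X
  act_left α H := by
    simp only [Iso.symm_hom]
    rw [Iso.comp_inv_eq, Category.assoc, M.map₂_whiskerRight, Iso.inv_hom_id_assoc]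
  act_right G H H' β := by
    simp only [Iso.symm_hom]
    rw [Iso.comp_inv_eq, Category.assoc, M.map₂_whiskerLeft, Iso.inv_hom_id_assoc]
  act_comp G H K := by
    exact M.mapComp_inv_assoc G H K X

/-- The Yoneda transformation from a homomorphism to the homomorphism of compatible families. -/
def ofObjTrans (M : CatRep J S) : CatTrans M ((rep M).restrict J) where
  app l :=
    { obj := fun X => ofObj M X
      map := fun f =>
        { app := fun G => (M.map G).map f
          map_app := fun α => (M.map₂_naturality α f).symm
          act_app := fun G H => by
            simp only [ofObj, Iso.symm_hom]
            rw [Iso.inv_comp_eq, reassoc_of% (M.mapComp_naturality G H f).symm, Iso.hom_inv_id,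
              Category.comp_id] } }
  nat F X := isoMk (fun G => (M.mapComp F G X).symm)
    (fun α => by
      simp only [ofObj, pull, rep, CatRep.restrict, Iso.symm_hom]
      rw [Iso.comp_inv_eq, Category.assoc, M.map₂_whiskerLeft, Iso.inv_hom_id_assoc])
    (fun G H => by
      change (M.mapComp G H ((M.map F).obj X)).inv ≫ (M.mapComp F (G ≫ H) X).inv =
        (M.map H).map (M.mapComp F G X).inv ≫ (M.mapComp (F ≫ G) H X).inv ≫ M.map₂ (α_ F G H).hom X
      rw [M.mapComp_inv_assoc, Iso.inv_hom_id_assoc])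
  nat_naturality F X Y f := by
    ext l G
    change (M.map G).map ((M.map F).map f) ≫ (M.mapComp F G Y).inv =
      (M.mapComp F G X).inv ≫ (M.map (F ≫ G)).map f
    rw [Iso.comp_inv_eq, Category.assoc, M.mapComp_naturality, Iso.inv_hom_id_assoc]
  nat_map₂ α X := by
    ext l G
    change (M.map G).map (M.map₂ α X) ≫ (M.mapComp _ G X).inv =
      (M.mapComp _ G X).inv ≫ M.map₂ (α ▷ G) X
    rw [Iso.comp_inv_eq, Category.assoc, M.map₂_whiskerRight, Iso.inv_hom_id_assoc]
  nat_id l X := by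
    ext m G
    change (M.mapComp _ G X).inv ≫ M.map₂ (λ_ G).hom X = (M.map G).map (M.mapId l X).hom
    rw [M.map₂_leftUnitor, Iso.inv_hom_id_assoc]
  nat_comp F G X := by
    ext m H
    change (M.mapComp (F ≫ G) H X).inv ≫ M.map₂ (α_ F G H).hom X =
      (M.map H).map (M.mapComp F G X).hom ≫ (M.mapComp G H _).inv ≫ (M.mapComp F (G ≫ H) X).inv
    rw [Iso.inv_comp_eq, ← reassoc_of% M.map₂_associator, Iso.hom_inv_id_assoc, Iso.hom_inv_id,
      Category.comp_id]

variable {M : CatRep J S} {N : CatRep J T}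

/-- The image of a family under a strong transformation. -/
@[simps]
def image (Λ : CatTrans M N) {i : C} (A : Family M i) : Family N i where
  obj {l} G := (Λ.app l).obj (A.obj G)
  map {l _ _} α := (Λ.app l).map (A.map α)
  act {l m} G H := (Λ.nat H (A.obj G)).symm ≪≫ (Λ.app m).mapIso (A.act G H)
  map_id G := by rw [A.map_id, CategoryTheory.Functor.map_id]
  map_comp α β := by rw [A.map_comp, Functor.map_comp]
  act_left α H := by
    simp only [Iso.trans_hom, Iso.symm_hom, Functor.mapIso_hom]
    rw [reassoc_of% Λ.nat_inv_naturality, ← Functor.map_comp, A.act_left, Functor.map_comp,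
      Category.assoc]
  act_right G H H' β := by
    simp only [Iso.trans_hom, Iso.symm_hom, Functor.mapIso_hom]
    rw [reassoc_of% Λ.nat_inv_map₂, ← Functor.map_comp, A.act_right, Functor.map_comp,
      Category.assoc]
  act_comp G H K := by
    simp only [Iso.trans_hom, Iso.symm_hom, Functor.mapIso_hom, A.act_comp, Functor.map_comp,
      Category.assoc]
    rw [reassoc_of% Λ.nat_inv_comp, reassoc_of% Λ.nat_inv_naturality]

/-- The strong transformation between homomorphisms of compatible families induced by a strong
transformation. -/
def imageTrans (Λ : CatTrans M N) : CatTrans (rep M) (rep N) where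
  app i :=
    { obj := fun A => A.image Λ
      map := fun f =>
        { app := fun {l} G => (Λ.app l).map (f.app G)
          map_app := fun α => by simp only [image, ← Functor.map_comp, f.map_app]
          act_app := fun G H => by
            simp only [image, Iso.trans_hom, Iso.symm_hom, Functor.mapIso_hom, Category.assoc,
              ← Functor.map_comp, f.act_app]
            rw [Functor.map_comp, ← reassoc_of% Λ.nat_inv_naturality] } }
  -- Pulling back reindexes a family while taking the image acts on its members, so the two
  -- operations give the same members.
  nat F A := isoMk (fun G => Iso.refl _)
    (fun α => (Category.comp_id _).trans (Category.id_comp _).symm)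
    (fun {l m} G H => by
      change ((Λ.nat H _).inv ≫ (Λ.app m).map ((A.act (F ≫ G) H).hom ≫ A.map _)) ≫ 𝟙 _ =
        (N.map H).map (𝟙 _) ≫ ((Λ.nat H _).inv ≫ (Λ.app m).map (A.act (F ≫ G) H).hom) ≫
          (Λ.app m).map (A.map _)
      simp)
  nat_naturality F A B f := by
    ext l G; exact (Category.comp_id _).trans (Category.id_comp _).symm
  nat_map₂ α A := by ext l G; exact (Category.comp_id _).trans (Category.id_comp _).symm
  nat_id i A := by ext l G; exact Category.id_comp _
  nat_comp F G A := by
    ext l K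
    change 𝟙 _ ≫ (Λ.app l).map (A.map _) = (Λ.app l).map (A.map _) ≫ 𝟙 _ ≫ 𝟙 _
    simp

/-- Restriction of the index set of a family. -/
@[simps]
def restrict {T : C → Type a₂} [∀ i, Category.{b₂} (T i)] {N : CatRep (fun i : C => i) T}
    {i : C} (A : Family N i) (J : ι → C) : Family (N.restrict J) i where
  obj G := A.obj G
  map α := A.map α
  act G H := A.act G H
  map_id G := A.map_id G
  map_comp α β := A.map_comp α β
  act_left α H := A.act_left α H
  act_right G _ _ β := A.act_right G β
  act_comp G H K := A.act_comp G H K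

/-- The Yoneda transformation of a homomorphism on `C`, with values in the families indexed by
a full sub-bicategory. -/
def restrictedYoneda {T : C → Type a₂} [∀ i, Category.{b₂} (T i)] (N : CatRep (fun i : C => i) T)
    (J : ι → C) : CatTrans N (rep (N.restrict J)) where
  app i :=
    { obj := fun X => (ofObj N X).restrict J
      map := fun f =>
        { app := fun G => (N.map G).map f
          map_app := fun α => (((ofObjTrans N).app i).map f).map_app α
          act_app := fun G H => (((ofObjTrans N).app i).map f).act_app G H } }
  nat F X := isoMk (fun G => (N.mapComp F G X).symm)
    (fun α => ((ofObjTrans N).nat F X).hom.map_app α)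
    (fun G H => ((ofObjTrans N).nat F X).hom.act_app G H)
  nat_naturality F X Y f := by
    ext l G; have h := congr_app ((ofObjTrans N).nat_naturality F f) G; exact h
  nat_map₂ α X := by
    ext l G; have h := congr_app ((ofObjTrans N).nat_map₂ α X) G; exact h
  nat_id i X := by
    ext l G; have h := congr_app ((ofObjTrans N).nat_id i X) G; exact h
  nat_comp F G X := by
    ext l H; have h := congr_app ((ofObjTrans N).nat_comp F G X) H; exact h

end Family

/-- A presentation of `i` as a retract of one of the objects `J l`. -/
structure RetractData (J : ι → C) (i : C) where
  index : ι
  proj : J index ⟶ i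
  incl : i ⟶ J index
  iso : incl ≫ proj ≅ 𝟙 i

/-! ### Families on a retract. -/

namespace Family

/-- The families obtained from an object along a 1-morphism. -/
def along (M : CatRep J S) {l : ι} {i : C} (F : J l ⟶ i) : S l ⥤ Family M i :=
  (ofObjTrans M).app l ⋙ (rep M).map F

/-- A family is determined by its value at the inclusion of a retract. -/
def alongEvalIso (M : CatRep J S) {i : C} (r : RetractData J i) :
    eval M r.incl ⋙ along M r.proj ≅ 𝟭 (Family M i) :=
  -- The action carries `A(incl)` along `proj ≫ G` to `A(incl ≫ (proj ≫ G))`, and the retraction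
  -- `incl ≫ proj ≅ 𝟙 i` identifies this with `A(G)`.
  NatIso.ofComponents (fun A => isoMk (fun G => A.act r.incl (r.proj ≫ G) ≪≫
      A.mapIso ((α_ _ _ _).symm ≪≫ whiskerRightIso r.iso G ≪≫ λ_ G))
    (fun {l G G'} α => by
      change M.map₂ (r.proj ◁ α) _ ≫ (A.act r.incl (r.proj ≫ G')).hom ≫ A.map _ =
        ((A.act r.incl (r.proj ≫ G)).hom ≫ A.map _) ≫ A.map α
      rw [reassoc_of% A.act_right, Category.assoc]
      congr 1
      have h := whisker_exchange_assoc r.iso.hom α (λ_ G').hom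
      exact A.map_square (by simpa using (α_ _ _ _).inv ≫= h))
    (fun {l m} G H => by
      change ((M.mapComp (r.proj ≫ G) H _).inv ≫ M.map₂ (α_ r.proj G H).hom _) ≫
          (A.act r.incl (r.proj ≫ G ≫ H)).hom ≫ A.map _ =
        (M.map H).map ((A.act r.incl (r.proj ≫ G)).hom ≫ A.map _) ≫ (A.act G H).hom
      rw [Category.assoc, reassoc_of% A.act_right, A.act_comp, Functor.map_comp, Category.assoc,
        Category.assoc, Category.assoc, Category.assoc, Iso.inv_hom_id_assoc, A.act_left]
      congr 2
      simp only [← A.map_comp]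
      congr 1
      simp))
    (fun {A B} f => by
      ext l G
      change (M.map (r.proj ≫ G)).map (f.app r.incl) ≫ (B.act r.incl (r.proj ≫ G)).hom ≫ B.map _ =
        ((A.act r.incl (r.proj ≫ G)).hom ≫ A.map _) ≫ f.app G
      rw [← reassoc_of% f.act_app, ← f.map_app, Category.assoc])

end Family

end Families

/-! ### Extension of transformations and modifications -/

section Extension

variable {C : Type u} [Bicategory.{w, v} C] {ι : Type u₁} {J : ι → C}

namespace Family

instance isEquivalence_ofObjTrans_app {S : ι → Type a₁} [∀ i, Category.{b₁} (S i)]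
    (M : CatRep J S) (l : ι) : ((ofObjTrans M).app l).IsEquivalence := by
  -- Every `J l` is a retract of itself through identities, so the quasi-inverse is evaluation at
  -- the identity.
  let r : RetractData J (J l) := ⟨l, 𝟙 _, 𝟙 _, λ_ _⟩
  let y := (ofObjTrans M).app l
  let unit : 𝟭 (S l) ≅ y ⋙ eval M (𝟙 (J l)) :=
    NatIso.ofComponents (fun X => (M.mapId l X).symm) (fun {X Y} f => by
      change f ≫ (M.mapId l Y).inv = (M.mapId l X).inv ≫ (M.map (𝟙 (J l))).map f
      rw [Iso.comp_inv_eq, Category.assoc, M.mapId_naturality, Iso.inv_hom_id_assoc])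
  let pullId : (rep M).map (𝟙 (J l)) ≅ 𝟭 _ :=
    NatIso.ofComponents ((rep M).mapId (J l)) (fun f => (rep M).mapId_naturality f)
  let counit : eval M (𝟙 (J l)) ⋙ y ≅ 𝟭 _ :=
    Functor.isoWhiskerLeft _ (y.rightUnitor.symm ≪≫ Functor.isoWhiskerLeft y pullId.symm) ≪≫
      alongEvalIso M r
  exact (CategoryTheory.Equivalence.mk y (eval M (𝟙 (J l))) unit counit).isEquivalence_functor

/-- The quasi-inverse sends a family `Z` to `N(proj) Z(incl)`. One composite is the identity because
`N(proj) N(incl) ≅ N(incl ≫ proj)`, the other because a family is recovered from its member at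
`incl`. -/
theorem isEquivalence_restrictedYoneda_app {T : C → Type a₂} [∀ i, Category.{b₂} (T i)]
    (N : CatRep (fun i : C => i) T) {i : C} (r : RetractData J i) :
    ((restrictedYoneda N J).app i).IsEquivalence := by
  let y := (restrictedYoneda N J).app i
  let g := eval (N.restrict J) r.incl ⋙ N.map r.proj
  let unit : 𝟭 (T i) ≅ y ⋙ g :=
    NatIso.ofComponents (fun X => (N.mapId i X).symm ≪≫ N.map₂Iso (i := i) (j := i) r.iso.symm X ≪≫
        N.mapComp r.incl r.proj X) (fun {X Y} f => by
      change f ≫ (N.mapId i Y).inv ≫ N.map₂ (i := i) (j := i) r.iso.inv Y ≫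
          (N.mapComp r.incl r.proj Y).hom =
        ((N.mapId i X).inv ≫ N.map₂ (i := i) (j := i) r.iso.inv X ≫
          (N.mapComp r.incl r.proj X).hom) ≫ (N.map r.proj).map ((N.map r.incl).map f)
      simp only [Category.assoc, ← N.mapComp_naturality]
      rw [← reassoc_of% N.map₂_naturality, Iso.eq_inv_comp, ← reassoc_of% N.mapId_naturality,
        Iso.hom_inv_id_assoc])
  -- Naturality of the Yoneda transformation at `proj` moves `N(proj)` to the side of families; at
  -- `J r.index` it agrees definitionally with the Yoneda transformation of the restriction, so
  -- `along` appears.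
  let counit : g ⋙ y ≅ 𝟭 _ :=
    Functor.associator _ _ _ ≪≫ Functor.isoWhiskerLeft (eval (N.restrict J) r.incl)
      (NatIso.ofComponents (fun Z => (restrictedYoneda N J).nat r.proj Z)
        (fun f => (restrictedYoneda N J).nat_naturality r.proj f) :
        N.map r.proj ⋙ y ≅ along (N.restrict J) r.proj) ≪≫ alongEvalIso (N.restrict J) r
  exact (CategoryTheory.Equivalence.mk y g unit counit).isEquivalence_functor

end Family

/-! ### Modifications extend uniquely from the subcategory. -/

section Modifications

variable {T : C → Type a₁} [∀ i, Category.{b₁} (T i)] {U : C → Type a₂}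
  [∀ i, Category.{b₂} (U i)] {M : CatRep (fun i : C => i) T} {N : CatRep (fun i : C => i) U}

/-- The morphisms `(N.map G).map f` are the members of the image of `f` under the restricted Yoneda
functor, which is faithful. Equations at an arbitrary `i` can thus be tested after moving to the
objects `J l`. -/
theorem CatRep.hom_ext_of_retract (N : CatRep (fun i : C => i) U) {i : C}
    (r : RetractData J i) {X Y : U i} {f g : X ⟶ Y}
    (h : ∀ (l : ι) (G : i ⟶ J l), (N.map G).map f = (N.map G).map g) : f = g := by
  have := Family.isEquivalence_restrictedYoneda_app N r
  refine ((Family.restrictedYoneda N J).app i).map_injective ?_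
  ext l G
  exact h l G

namespace CatMod

variable {Λ Θ : CatTrans M N}

/-- The components of a modification of restricted transformations. -/
def restrictApp (Γ : CatMod (Λ.restrict J) (Θ.restrict J)) (l : ι) (X : T (J l)) :
    (Λ.app (J l)).obj X ⟶ (Θ.app (J l)).obj X :=
  Γ.app l X

/-- The axioms of `Γ` are restated with the components of `Λ` and `Θ` themselves instead of those of
their restrictions, which is the form needed for rewriting. -/
theorem restrictApp_naturality (Γ : CatMod (Λ.restrict J) (Θ.restrict J)) (l : ι) {X Y : T (J l)}
    (f : X ⟶ Y) :
    (Λ.app (J l)).map f ≫ Γ.restrictApp l Y = Γ.restrictApp l X ≫ (Θ.app (J l)).map f :=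
  Γ.naturality f

theorem restrictApp_map (Γ : CatMod (Λ.restrict J) (Θ.restrict J)) {l m : ι} (F : J l ⟶ J m)
    (X : T (J l)) :
    Γ.restrictApp m ((M.map F).obj X) ≫ (Θ.nat F X).hom =
      (Λ.nat F X).hom ≫ (N.map F).map (Γ.restrictApp l X) :=
  Γ.app_map F X

/-- The images under the 1-morphisms out of `i` of the prospective component at `i` of an extended
modification. -/
def extendFamily (Γ : CatMod (Λ.restrict J) (Θ.restrict J)) (i : C) (X : T i) :
    ((Family.restrictedYoneda N J).app i).obj ((Λ.app i).obj X) ⟶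
      ((Family.restrictedYoneda N J).app i).obj ((Θ.app i).obj X) where
  -- The modification axiom at `G` forces this value.
  app {l} G := (Λ.nat G X).inv ≫ Γ.restrictApp l ((M.map G).obj X) ≫ (Θ.nat G X).hom
  map_app {l G G'} α := by
    change N.map₂ α _ ≫ (Λ.nat G' X).inv ≫ Γ.restrictApp l ((M.map G').obj X) ≫
        (Θ.nat G' X).hom =
      ((Λ.nat G X).inv ≫ Γ.restrictApp l ((M.map G).obj X) ≫ (Θ.nat G X).hom) ≫ N.map₂ α _
    rw [reassoc_of% Λ.nat_inv_map₂, reassoc_of% Γ.restrictApp_naturality, Θ.nat_map₂]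
    simp only [Category.assoc]
  act_app {l m} G H := by
    change (N.mapComp G H _).inv ≫ (Λ.nat (G ≫ H) X).inv ≫
        Γ.restrictApp m ((M.map (G ≫ H)).obj X) ≫ (Θ.nat (G ≫ H) X).hom =
      (N.map H).map ((Λ.nat G X).inv ≫ Γ.restrictApp l ((M.map G).obj X) ≫ (Θ.nat G X).hom) ≫
        (N.mapComp G H _).inv
    rw [Iso.inv_comp_eq, ← Category.assoc, ← Category.assoc, ← Category.assoc, Iso.eq_comp_inv]
    simp only [Category.assoc, Functor.map_comp]
    rw [Θ.nat_comp, ← reassoc_of% Γ.restrictApp_naturality, reassoc_of% Λ.nat_inv_comp,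
      reassoc_of% Γ.restrictApp_map, Iso.inv_hom_id_assoc]

/-- The extension of a modification. -/
def extend (r : ∀ i, RetractData J i) (Γ : CatMod (Λ.restrict J) (Θ.restrict J)) : CatMod Λ Θ :=
  have := fun i => Family.isEquivalence_restrictedYoneda_app N (r i)
  -- This characterises the extended component by all its images under `N.map G`; both axioms then
  -- follow by testing on those images.
  have key : ∀ (i : C) (X : T i) (l : ι) (G : i ⟶ J l),
      (N.map G).map (((Family.restrictedYoneda N J).app i).preimage (Γ.extendFamily i X)) =
        (Λ.nat G X).inv ≫ Γ.restrictApp l ((M.map G).obj X) ≫ (Θ.nat G X).hom := fun i X l G =>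
    Family.congr_app (((Family.restrictedYoneda N J).app i).map_preimage (Γ.extendFamily i X)) G
  { app := fun i X => ((Family.restrictedYoneda N J).app i).preimage (Γ.extendFamily i X)
    naturality := fun {i X Y} f => N.hom_ext_of_retract (r i) fun l G => by
      rw [Functor.map_comp, Functor.map_comp, key, key, reassoc_of% Λ.nat_inv_naturality,
        reassoc_of% Γ.restrictApp_naturality, Θ.nat_naturality]
      simp only [Category.assoc]
    app_map := fun {i j} F X => N.hom_ext_of_retract (r j) fun l G => by
      have h := N.mapComp_naturality F G
        (((Family.restrictedYoneda N J).app i).preimage (Γ.extendFamily i X))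
      rw [key, ← Iso.inv_comp_eq] at h
      have e₁ := Θ.nat_comp F G X
      have e₂ := Λ.nat_inv_comp F G X
      rw [Functor.map_comp, Functor.map_comp, key, ← h]
      simp only [Category.assoc]
      rw [e₁, ← reassoc_of% Γ.restrictApp_naturality, reassoc_of% e₂, Iso.inv_hom_id_assoc,
        ← Functor.map_comp_assoc, Iso.hom_inv_id, CategoryTheory.Functor.map_id,
        Category.id_comp] }

/-- The given component already has the images prescribed by `extendFamily`, by the modification
axiom of `Γ`, so uniqueness applies. -/
theorem extend_app (r : ∀ i, RetractData J i)
    (Γ : CatMod (Λ.restrict J) (Θ.restrict J)) (l : ι) (X : T (J l)) :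
    (Γ.extend r).app (J l) X = Γ.app l X := by
  have := fun i => Family.isEquivalence_restrictedYoneda_app N (r i)
  change _ = Γ.restrictApp l X
  refine N.hom_ext_of_retract (r (J l)) fun m G => ?_
  have h : (N.map G).map ((Γ.extend r).app (J l) X) =
      (Λ.nat G X).inv ≫ Γ.restrictApp m ((M.map G).obj X) ≫ (Θ.nat G X).hom :=
    Family.congr_app
      (((Family.restrictedYoneda N J).app (J l)).map_preimage (Γ.extendFamily (J l) X)) G
  rw [h, Γ.restrictApp_map, Iso.inv_hom_id_assoc]

theorem eq_of_restrict_eq (r : ∀ i, RetractData J i) {Γ Γ' : CatMod Λ Θ} (h : ∀ l X, Γ.app (J l) X = Γ'.app (J l) X) (i : C)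
    (X : T i) : Γ.app i X = Γ'.app i X := by
  refine N.hom_ext_of_retract (r i) fun l G => ?_
  rw [← cancel_epi (Λ.nat G X).hom, ← Γ.app_map, ← Γ'.app_map, h]

end CatMod

end Modifications

/-! ### Mates and the unit and counit of an inverse transformation. -/

section Lifting

variable {S : ι → Type a₁} [∀ i, Category.{b₁} (S i)] {T : ι → Type a₂} [∀ i, Category.{b₂} (T i)]
  {U : ι → Type a₃} [∀ i, Category.{b₃} (U i)] {M : CatRep J S} {N : CatRep J T} {B : CatRep J U}

theorem CatTrans.map_mapComp_inv_nat (Λ : CatTrans M N) {i j l : ι} (F : J i ⟶ J j)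
    (G : J j ⟶ J l) (X : S i) :
    (Λ.app l).map (M.mapComp F G X).inv ≫ (Λ.nat (F ≫ G) X).hom =
      (Λ.nat G ((M.map F).obj X)).hom ≫ (N.map G).map (Λ.nat F X).hom ≫
        (N.mapComp F G ((Λ.app i).obj X)).inv := by
  rw [← cancel_mono (N.mapComp F G ((Λ.app i).obj X)).hom]
  simp only [Category.assoc, Iso.inv_hom_id, Category.comp_id]
  rw [Λ.nat_comp, ← Functor.map_comp_assoc, Iso.inv_hom_id, CategoryTheory.Functor.map_id,
    Category.id_comp]

/-- The identity strong transformation. -/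
def CatTrans.id (M : CatRep J S) : CatTrans M M where
  app i := 𝟭 _
  nat F X := Iso.refl _
  nat_naturality F X Y f := by simp
  nat_map₂ α X := by simp
  nat_id i X := by simp
  nat_comp F G X := by simp

/-- A modification from a strong transformation to one that factors through a strong transformation
with invertible components, transposed. -/
def CatMod.transpose {P : CatTrans M B} {L : CatTrans M N} {E : CatTrans N B}
    (σ : CatMod P (L.comp E)) (q : ∀ i, AdjInverse (E.app i)) :
    CatMod (P.comp (E.inverse q)) L where
  app i X := (q i).inv.map (σ.app i X) ≫ ((q i).unit _).inv
  naturality {i X Y} f := by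
    have h := σ.naturality f
    simp only [CatTrans.comp, Functor.comp_map, Functor.comp_obj] at h
    simp only [CatTrans.comp, CatTrans.inverse, Functor.comp_map, Category.assoc]
    rw [← (q i).unit_inv_naturality, ← Functor.map_comp_assoc, h, Functor.map_comp_assoc]
  app_map {i j} F X := by
    have h := σ.app_map F X
    simp only [CatTrans.comp, Functor.comp_obj, Iso.trans_hom, Functor.mapIso_hom] at h
    simp only [CatTrans.comp, CatTrans.inverse, Iso.trans_hom, Functor.mapIso_hom, Iso.symm_hom,
      Category.assoc, Functor.comp_obj]
    rw [← (q j).unit_inv_naturality, ← (q j).unit_inv_naturality]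
    simp only [← Functor.map_comp_assoc, Category.assoc]
    rw [← E.nat_inv_naturality, ← Functor.map_comp_assoc (B.map F), Functor.map_comp (E.app i),
      (q i).map_unit_inv, (q i).counit_naturality, Iso.inv_hom_id_assoc, ← reassoc_of% h,
      Iso.hom_inv_id, Category.comp_id]

/-- The counit of the inverse of a strong transformation with invertible components. -/
def CatTrans.inverseComp (E : CatTrans N B) (q : ∀ i, AdjInverse (E.app i)) :
    CatMod ((E.inverse q).comp E) (CatTrans.id B) where
  app i X := ((q i).counit X).hom
  naturality f := (q _).counit_naturality f
  app_map {i j} F X := by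
    simp only [CatTrans.comp, CatTrans.inverse, CatTrans.id, Iso.trans_hom, Functor.mapIso_hom,
      Iso.symm_hom, Functor.map_comp, Iso.refl_hom, Functor.comp_obj, Functor.id_obj,
      Category.assoc, (q j).map_unit_inv]
    rw [reassoc_of% (q j).counit_naturality, reassoc_of% (q j).counit_naturality,
      Iso.inv_hom_id_assoc, ← Functor.map_comp, Iso.inv_hom_id, CategoryTheory.Functor.map_id]

/-- The unit of the inverse of a strong transformation with invertible components. -/
def CatTrans.compInverse (E : CatTrans N B) (q : ∀ i, AdjInverse (E.app i)) :
    CatMod (E.comp (E.inverse q)) (CatTrans.id N) where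
  app i X := ((q i).unit X).inv
  naturality f := (q _).unit_inv_naturality f
  app_map {i j} F X := by
    simp only [CatTrans.comp, CatTrans.inverse, CatTrans.id, Iso.trans_hom, Functor.mapIso_hom,
      Iso.symm_hom, Iso.refl_hom, Functor.comp_obj, Functor.id_obj, Category.assoc]
    rw [← (q j).unit_inv_naturality ((N.map F).map ((q i).unit X).inv), ← Functor.map_comp_assoc,
      ← Functor.map_comp_assoc, Category.assoc, Category.assoc, ← E.nat_inv_naturality, (q i).map_unit_inv,
      ← Functor.map_comp_assoc, Iso.inv_hom_id, CategoryTheory.Functor.map_id, Category.id_comp,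
      Iso.hom_inv_id, CategoryTheory.Functor.map_id, Category.comp_id, Category.id_comp]

end Lifting

/-! ### Extension of strong transformations. -/

section Transformations

variable {T : C → Type a₁} [∀ i, Category.{b₁} (T i)] {U : C → Type a₂}
  [∀ i, Category.{b₂} (U i)] {M : CatRep (fun i : C => i) T} {N : CatRep (fun i : C => i) U}

/-- The extension of a strong transformation. -/
def CatTrans.extend (Λ : CatTrans (M.restrict J) (N.restrict J))
    (q : ∀ i, AdjInverse ((Family.restrictedYoneda N J).app i)) : CatTrans M N :=
  -- At each `i`: pass to the family of images over `J`, apply `Λ` to every member, and return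
  -- through the inverse Yoneda functor of `N`.
  ((Family.restrictedYoneda M J).comp (Family.imageTrans Λ)).comp
    ((Family.restrictedYoneda N J).inverse q)

/-- The compatibility of strong transformations with the Yoneda transformations. -/
def CatTrans.yonedaMod (Λ : CatTrans (M.restrict J) (N.restrict J)) :
    CatMod (((Family.restrictedYoneda M J).comp (Family.imageTrans Λ)).restrict J)
      (Λ.comp ((Family.restrictedYoneda N J).restrict J)) where
  app l X :=
    { app := fun {m} G => (Λ.nat G X).hom
      map_app := fun α => Λ.nat_map₂ α X
      act_app := fun {m n} G H => by
        change ((Λ.nat H _).inv ≫ (Λ.app n).map (M.mapComp G H X).inv) ≫ (Λ.nat (G ≫ H) X).hom =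
          (N.map H).map (Λ.nat G X).hom ≫ (N.mapComp G H _).inv
        have h := Λ.map_mapComp_inv_nat G H X
        exact (Category.assoc _ _ _).trans ((Iso.inv_comp_eq _).2 h) }
  naturality {i X Y} f := by
    ext m G
    exact Λ.nat_naturality G f
  app_map {i j} F X := by
    ext m G
    change (Λ.nat G ((M.map F).obj X)).hom ≫ (N.map G).map (Λ.nat F X).hom ≫
        (N.mapComp F G _).inv =
      ((Λ.app m).map (M.mapComp F G X).inv ≫ 𝟙 _) ≫ (Λ.nat (F ≫ G) X).hom
    rw [Category.comp_id]
    exact (Λ.map_mapComp_inv_nat F G X).symm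

/-- The extension of a strong transformation restricts to the given one. -/
def CatTrans.extendRestrict (Λ : CatTrans (M.restrict J) (N.restrict J))
    (q : ∀ i, AdjInverse ((Family.restrictedYoneda N J).app i)) :
    CatMod ((Λ.extend q).restrict J) Λ :=
  Λ.yonedaMod.transpose (E := (Family.restrictedYoneda N J).restrict J) (fun l => q (J l))

end Transformations

end Extension

/-! ### Comparison with homomorphisms to the 2-category of finitary categories -/

section Comparison

variable {k : Type w} [Field k]

namespace FinAddCat

theorem congr_app {A B : FinAddCat.{w, v, u} k} {F G : A ⟶ B} {α β : F ⟶ G} (h : α = β)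
    (X : A.carrier) : α.natTrans.app X = β.natTrans.app X := by
  rw [h]

/-- The components of a 2-isomorphism. -/
@[simps]
def isoApp {A B : FinAddCat.{w, v, u} k} {F G : A ⟶ B} (α : F ≅ G) (X : A.carrier) :
    F.functor.obj X ≅ G.functor.obj X where
  hom := α.hom.natTrans.app X
  inv := α.inv.natTrans.app X
  hom_inv_id := congr_app α.hom_inv_id X
  inv_hom_id := congr_app α.inv_hom_id X

/-- A 2-isomorphism from its components. -/
@[simps!]
def isoOfComponents {A B : FinAddCat.{w, v, u} k} {F G : A ⟶ B}
    (e : ∀ X, F.functor.obj X ≅ G.functor.obj X)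
    (h : ∀ {X Y : A.carrier} (f : X ⟶ Y),
      F.functor.map f ≫ (e Y).hom = (e X).hom ≫ G.functor.map f) : F ≅ G :=
  mkIso₂ (NatIso.ofComponents e h)

end FinAddCat

variable {C : Type u} [Bicategory.{w₁, v} C]

namespace CatRep

/-- The category-valued homomorphism underlying a 2-representation. -/
def ofAfmod (M : Afmod.{w, w₁, v, v₂, u, u₂} k C) :
    CatRep (fun i : C => i) (fun i => (M.obj i).carrier) where
  map F := (M.map F).functor
  map₂ α X := (M.map₂ α).natTrans.app X
  mapId i X := FinAddCat.isoApp (M.mapId i) X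
  mapComp F G X := FinAddCat.isoApp (M.mapComp F G) X
  map₂_naturality α X Y f := (M.map₂ α).natTrans.naturality f
  map₂_id F X := FinAddCat.congr_app (M.map₂_id F) X
  map₂_comp α β X := FinAddCat.congr_app (M.map₂_comp α β) X
  mapId_naturality {i} X Y f := (M.mapId i).hom.natTrans.naturality f
  mapComp_naturality F G X Y f := (M.mapComp F G).hom.natTrans.naturality f
  map₂_whiskerLeft F G G' β X := by
    have h : M.map₂ (F ◁ β) ≫ (M.mapComp F G').hom =
      (M.mapComp F G).hom ≫ M.map F ◁ M.map₂ β := by simp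
    exact FinAddCat.congr_app h X
  map₂_whiskerRight {i j l F F'} α G X := by
    have h : M.map₂ (α ▷ G) ≫ (M.mapComp F' G).hom =
      (M.mapComp F G).hom ≫ M.map₂ α ▷ M.map G := by simp
    exact FinAddCat.congr_app h X
  map₂_associator F G H X := by
    have h : M.map₂ (α_ F G H).hom ≫ (M.mapComp F (G ≫ H)).hom ≫ M.map F ◁ (M.mapComp G H).hom =
      (M.mapComp (F ≫ G) H).hom ≫ (M.mapComp F G).hom ▷ M.map H ≫ (α_ _ _ _).hom := by simp
    exact (FinAddCat.congr_app h X).trans (congrArg _ (Category.comp_id _))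
  map₂_leftUnitor F X := by
    have h := M.map₂_left_unitor F
    exact (FinAddCat.congr_app h X).trans (congrArg _ (Category.comp_id _))
  map₂_rightUnitor F X := by
    have h := M.map₂_right_unitor F
    exact (FinAddCat.congr_app h X).trans (congrArg _ (Category.comp_id _))

/-- The 2-representation given by a category-valued homomorphism with linear functors between
finitary categories. -/
def toAfmod {S : C → FinAddCat.{w, v₂, u₂} k}
    (R : CatRep (fun i : C => i) (fun i => (S i).carrier))
    (hR : ∀ {i j : C} (F : i ⟶ j), IsLinearFunctor k _ _ (R.map F)) :
    Afmod.{w, w₁, v, v₂, u, u₂} k C where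
  obj := S
  map F := ⟨R.map F, hR F⟩
  map₂ α := ⟨{ app := R.map₂ α, naturality := fun _ _ f => R.map₂_naturality α f }⟩
  map₂_id F := FinAddCat.hom₂_ext (R.map₂_id F)
  map₂_comp α β := FinAddCat.hom₂_ext (R.map₂_comp α β)
  mapId i := FinAddCat.isoOfComponents (R.mapId i) R.mapId_naturality
  mapComp F G := FinAddCat.isoOfComponents (R.mapComp F G) (R.mapComp_naturality F G)
  map₂_whisker_left F G G' β := FinAddCat.hom₂_ext fun X => by
    have h := R.map₂_whiskerLeft F β X
    rw [← Iso.eq_comp_inv, Category.assoc] at h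
    exact h
  map₂_whisker_right {i j l F F'} α G := FinAddCat.hom₂_ext fun X => by
    have h := R.map₂_whiskerRight α G X
    rw [← Iso.eq_comp_inv, Category.assoc] at h
    exact h
  map₂_associator F G H := FinAddCat.hom₂_ext fun X => by
    have h := R.map₂_associator F G H X
    rw [← Category.assoc, ← Iso.eq_comp_inv, ← Iso.eq_comp_inv] at h
    refine h.trans ?_
    simp only [Category.assoc]
    exact congrArg _ (congrArg _ (Category.id_comp _).symm)
  map₂_left_unitor F := FinAddCat.hom₂_ext fun X =>
    (R.map₂_leftUnitor F X).trans (congrArg _ (Category.comp_id _).symm)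
  map₂_right_unitor F := FinAddCat.hom₂_ext fun X =>
    (R.map₂_rightUnitor F X).trans (congrArg _ (Category.comp_id _).symm)

end CatRep

variable {M N : Afmod.{w, w₁, v, v₂, u, u₂} k C}

/-- Associators of `FinAddCat` have identity components; this removes them from the composition
axiom of a strong transformation. -/
theorem comp_ids {𝒜 : Type u} [Category.{v} 𝒜] {X Y Z W : 𝒜} (f : X ⟶ Y) (g : Y ⟶ Z)
    (h : Z ⟶ W) : f ≫ 𝟙 _ ≫ g ≫ 𝟙 _ ≫ h ≫ 𝟙 _ = f ≫ g ≫ h := by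
  simp

namespace CatTrans

/-- The strong transformation of category-valued homomorphisms underlying a strong transformation
of 2-representations. -/
def ofStrongTrans (Λ : M ⟶ N) : CatTrans (CatRep.ofAfmod M) (CatRep.ofAfmod N) where
  app i := (Λ.app i).functor
  nat F X := FinAddCat.isoApp (Λ.naturality F) X
  nat_naturality F X Y f := (Λ.naturality F).hom.natTrans.naturality f
  nat_map₂ α X := FinAddCat.congr_app (Λ.naturality_naturality α) X
  nat_id i X := (FinAddCat.congr_app (Λ.naturality_id i) X).trans
    ((congrArg _ (Category.comp_id _)).trans (Category.comp_id _))
  nat_comp F G X := by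
    exact (FinAddCat.congr_app (Λ.naturality_comp F G) X).trans (comp_ids _ _ _)

/-- The strong transformation of 2-representations given by linear components. -/
def toStrongTrans (Λ : CatTrans (CatRep.ofAfmod M) (CatRep.ofAfmod N))
    (hΛ : ∀ i, IsLinearFunctor k _ _ (Λ.app i)) : M ⟶ N where
  app i := ⟨Λ.app i, hΛ i⟩
  naturality F := FinAddCat.isoOfComponents (Λ.nat F) (Λ.nat_naturality F)
  naturality_naturality α := FinAddCat.hom₂_ext (Λ.nat_map₂ α)
  naturality_id i := FinAddCat.hom₂_ext fun X => by
    refine (Λ.nat_id i X).trans ?_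
    exact ((congrArg _ (Category.comp_id _)).trans (Category.comp_id _)).symm
  naturality_comp F G := FinAddCat.hom₂_ext fun X => by
    exact (Λ.nat_comp F G X).trans (comp_ids _ _ _).symm

end CatTrans

theorem CatTrans.ofStrongTrans_comp_nat {P : Afmod.{w, w₁, v, v₂, u, u₂} k C} (Λ : M ⟶ N)
    (Θ : N ⟶ P) {i j : C} (F : i ⟶ j) (X : (M.obj i).carrier) :
    ((ofStrongTrans (Λ ≫ Θ)).nat F X).hom =
      (((ofStrongTrans Λ).comp (ofStrongTrans Θ)).nat F X).hom := by
  have h : ((Λ ≫ Θ).naturality F).hom = (α_ _ _ _).inv ≫ (Λ.naturality F).hom ▷ Θ.app j ≫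
      (α_ _ _ _).hom ≫ Λ.app i ◁ (Θ.naturality F).hom ≫ (α_ _ _ _).inv := by
    simp; rfl
  exact (FinAddCat.congr_app h X).trans ((Category.id_comp _).trans
    (congrArg _ ((Category.id_comp _).trans (Category.comp_id _))))

theorem CatTrans.ofStrongTrans_id_nat {i j : C} (F : i ⟶ j) (X : (M.obj i).carrier) :
    ((ofStrongTrans (𝟙 M)).nat F X).hom = ((CatTrans.id (CatRep.ofAfmod M)).nat F X).hom :=
  Category.comp_id _

namespace CatMod

variable {Λ Θ : M ⟶ N}

/-- The modification of category-valued transformations underlying a modification. -/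
def ofModification (Γ : Λ ⟶ Θ) :
    CatMod (CatTrans.ofStrongTrans Λ) (CatTrans.ofStrongTrans Θ) where
  app i X := (Γ.as.app i).natTrans.app X
  naturality {i _ _} f := (Γ.as.app i).natTrans.naturality f
  app_map F X := FinAddCat.congr_app (Γ.as.naturality F) X

/-- The modification given by its components. -/
def toModification (Γ : CatMod (CatTrans.ofStrongTrans Λ) (CatTrans.ofStrongTrans Θ)) :
    Λ ⟶ Θ :=
  ⟨{ app := fun i => ⟨{ app := Γ.app i, naturality := fun _ _ f => Γ.naturality f }⟩
     naturality := fun F => FinAddCat.hom₂_ext (Γ.app_map F) }⟩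

/-- The isomorphism of strong transformations given by a modification with invertible components. -/
def toIso (Γ : CatMod (CatTrans.ofStrongTrans Λ) (CatTrans.ofStrongTrans Θ))
    (h : ∀ i X, IsIso (Γ.app i X)) : Λ ≅ Θ :=
  Pseudofunctor.StrongTrans.isoMk
    (fun i => FinAddCat.isoOfComponents (fun X => @asIso _ _ _ _ (Γ.app i X) (h i X))
      (fun f => Γ.naturality f))
    (fun F => FinAddCat.hom₂_ext (Γ.app_map F))

end CatMod

/-- A strong transformation of 2-representations whose components are equivalences of categories
is an equivalence. -/
theorem nonempty_equivalence_of_isEquivalence (Λ : M ⟶ N)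
    (h : ∀ i, (Λ.app i).functor.IsEquivalence) : Nonempty (M ≌ N) := by
  let E := CatTrans.ofStrongTrans Λ
  have : ∀ i, (E.app i).IsEquivalence := h
  let q := fun i => AdjInverse.ofIsEquivalence (E.app i)
  have hq : ∀ i, IsLinearFunctor k _ _ ((E.inverse q).app i) := fun i => by
    have := (Λ.app i).property.1
    have := (Λ.app i).property.2
    have : (E.app i).asEquivalence.functor.Additive := (Λ.app i).property.1
    have : (E.app i).asEquivalence.functor.Linear k := (Λ.app i).property.2
    exact ⟨(E.app i).asEquivalence.inverse_additive, Equivalence.inverseLinear k (E.app i).asEquivalence⟩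
  let Θ := (E.inverse q).toStrongTrans hq
  let unitMod : CatMod (CatTrans.ofStrongTrans (Λ ≫ Θ)) (CatTrans.ofStrongTrans (𝟙 M)) :=
    { app := fun i X => ((q i).unit X).inv
      naturality := fun f => (q _).unit_inv_naturality f
      app_map := fun {i j} F X => by
        rw [CatTrans.ofStrongTrans_comp_nat, CatTrans.ofStrongTrans_id_nat]
        exact (E.compInverse q).app_map F X }
  let counitMod : CatMod (CatTrans.ofStrongTrans (Θ ≫ Λ)) (CatTrans.ofStrongTrans (𝟙 N)) :=
    { app := fun i X => ((q i).counit X).hom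
      naturality := fun f => (q _).counit_naturality f
      app_map := fun {i j} F X => by
        rw [CatTrans.ofStrongTrans_comp_nat, CatTrans.ofStrongTrans_id_nat]
        exact (E.inverseComp q).app_map F X }
  exact ⟨Bicategory.Equivalence.mkOfAdjointifyCounit
    (unitMod.toIso fun i X => inferInstanceAs (IsIso ((q i).unit X).inv)).symm
    (counitMod.toIso fun i X => inferInstanceAs (IsIso ((q i).counit X).hom))⟩

end Comparison

/-! ### Retracts of finitary categories -/

section Finitary

variable {k : Type w} [Field k] {𝒜 : Type u} [Category.{v} 𝒜] [Preadditive 𝒜] [Linear k 𝒜]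
  {ℬ : Type u₁} [Category.{v₁} ℬ] [Preadditive ℬ]

theorem IsIndecomposable.of_iso [HasFiniteBiproducts 𝒜] {X Y : 𝒜} (e : X ≅ Y)
    (h : IsIndecomposable X) : IsIndecomposable Y :=
  haveI := hasBinaryBiproducts_of_finite_biproducts 𝒜
  ⟨fun hY => h.1 (hY.of_iso e), fun Z W f => h.2 Z W (e ≪≫ f)⟩

/-- Block diagonal endomorphisms embed `End Y × End Z` into `End X`, and `End Z` is nonzero. -/
theorem finrank_end_lt_left [HasBinaryBiproducts 𝒜] (hfin : ∀ X Y : 𝒜, Module.Finite k (X ⟶ Y))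
    {X Y Z : 𝒜} (e : X ≅ Y ⊞ Z) (hZ : ¬ IsZero Z) :
    Module.finrank k (End Y) < Module.finrank k (End X) := by
  have := hfin
  have h1 : 0 < Module.finrank k (Z ⟶ Z) := by
    rw [Module.finrank_pos_iff]
    exact ⟨𝟙 Z, 0, fun h => hZ ((IsZero.iff_id_eq_zero Z).2 h)⟩
  let φ : (Y ⟶ Y) × (Z ⟶ Z) →ₗ[k] (X ⟶ X) :=
    { toFun := fun f => e.hom ≫ biprod.map f.1 f.2 ≫ e.inv
      map_add' := fun f g => by
        rw [← Preadditive.comp_add, ← Preadditive.add_comp]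
        congr 2
        ext <;> simp
      map_smul' := fun r f => by
        rw [RingHom.id_apply, ← Linear.comp_smul, ← Linear.smul_comp]
        congr 2
        ext <;> simp }
  have h2 : Function.Injective φ := fun f g h => by
    have h' : biprod.map f.1 f.2 = biprod.map g.1 g.2 := by simpa [φ] using h
    refine Prod.ext ?_ ?_
    · simpa using congrArg (fun a => biprod.inl ≫ a ≫ biprod.fst) h'
    · simpa using congrArg (fun a => biprod.inr ≫ a ≫ biprod.snd) h'
  have h3 := LinearMap.finrank_le_finrank_of_injective h2
  rw [Module.finrank_prod] at h3
  change Module.finrank k (Y ⟶ Y) < Module.finrank k (X ⟶ X)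
  omega

/-- If `X` splits into nonzero summands, indecomposability of `p.obj X` forces `p` to kill one of
them, and the other has the same image. Its endomorphism algebra has smaller dimension, so the
induction terminates. -/
theorem exists_isIndecomposable_of_map [IsFinitaryCategory k 𝒜] [HasFiniteBiproducts ℬ]
    (p : 𝒜 ⥤ ℬ) [p.Additive] (X : 𝒜) (h : IsIndecomposable (p.obj X)) :
    ∃ Y : 𝒜, IsIndecomposable Y ∧ Nonempty (p.obj X ≅ p.obj Y) := by
  have := hasBinaryBiproducts_of_finite_biproducts 𝒜
  have := hasBinaryBiproducts_of_finite_biproducts ℬ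
  have := preservesBinaryBiproducts_of_preservesBiproducts p
  induction hn : Module.finrank k (End X) using Nat.strong_induction_on generalizing X with
  | _ n ih =>
    by_cases hX : IsIndecomposable X
    · exact ⟨X, hX, ⟨Iso.refl _⟩⟩
    have hX0 : ¬ IsZero X := fun h0 => h.1 (p.map_isZero h0)
    have : ∃ Y Z : 𝒜, ∃ _ : X ≅ Y ⊞ Z, ¬ IsZero Y ∧ ¬ IsZero Z := by
      by_contra hc
      push Not at hc
      exact hX ⟨hX0, fun Y Z e => or_iff_not_imp_left.2 (hc Y Z e)⟩
    obtain ⟨Y, Z, e, hY, hZ⟩ := this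
    let e' : p.obj X ≅ p.obj Y ⊞ p.obj Z := p.mapIso e ≪≫ p.mapBiprod Y Z
    have hfin := IsFinitaryCategory.finite_hom (k := k) (𝒜 := 𝒜)
    rcases h.2 _ _ e' with h0 | h0
    · have f : p.obj X ≅ p.obj Z := e' ≪≫ (isoZeroBiprod h0).symm
      obtain ⟨W, hW, ⟨g⟩⟩ := ih _ (hn ▸ finrank_end_lt_left hfin (e ≪≫ biprod.braiding Y Z) hY)
        Z (h.of_iso f) rfl
      exact ⟨W, hW, ⟨f ≪≫ g⟩⟩
    · have f : p.obj X ≅ p.obj Y := e' ≪≫ (isoBiprodZero h0).symm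
      obtain ⟨W, hW, ⟨g⟩⟩ := ih _ (hn ▸ finrank_end_lt_left hfin e hZ) Y (h.of_iso f) rfl
      exact ⟨W, hW, ⟨f ≪≫ g⟩⟩

variable [Linear k ℬ]

/-- A retract of a finitary category is finitary. -/
theorem IsFinitaryCategory.of_retract [IsFinitaryCategory k 𝒜] (s : ℬ ⥤ 𝒜) (p : 𝒜 ⥤ ℬ)
    [s.Additive] [s.Linear k] [p.Additive] (e : s ⋙ p ≅ 𝟭 ℬ) : IsFinitaryCategory k ℬ := by
  -- A finite family is moved to `𝒜` by `s` and its product is brought back by the additive functor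
  -- `p`, which preserves it.
  have hprod : HasFiniteProducts ℬ := ⟨fun n => ⟨fun K => by
    have : HasLimit ((K ⋙ s) ⋙ p) :=
      HasLimit.mk ⟨_, isLimitOfPreserves p (limit.isLimit (K ⋙ s))⟩
    exact hasLimit_of_iso (F := (K ⋙ s) ⋙ p)
      (Functor.associator _ _ _ ≪≫ Functor.isoWhiskerLeft K e ≪≫ K.rightUnitor)⟩⟩
  have hbi : HasFiniteBiproducts ℬ := HasFiniteBiproducts.of_hasFiniteProducts
  have hs : s.Faithful := by
    have : (s ⋙ p).Faithful := Functor.Faithful.of_iso e.symm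
    exact Functor.Faithful.of_comp s p
  have hsplit : IsIdempotentComplete ℬ := ⟨fun X f hf => by
    obtain ⟨Z, i, r, h₁, h₂⟩ := IsIdempotentComplete.idempotents_split (s.obj X) (s.map f)
      (by rw [← s.map_comp, hf])
    refine ⟨p.obj Z, p.map i ≫ e.hom.app X, e.inv.app X ≫ p.map r, ?_, ?_⟩
    · have h := e.hom_inv_id_app X
      simp only [Functor.comp_obj] at h
      rw [Category.assoc, reassoc_of% h, ← p.map_comp, h₁, p.map_id]
    · rw [Category.assoc, ← p.map_comp_assoc, h₂]
      exact (NatIso.naturality_1 e f)⟩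
  exact
    { finite_hom := fun X Y => by
        have := IsFinitaryCategory.finite_hom (k := k) (s.obj X) (s.obj Y)
        exact Module.Finite.of_injective (s.mapLinearMap k) s.map_injective
      finite_indecomposables := by
        obtain ⟨t, ht, h⟩ := IsFinitaryCategory.finite_indecomposables (k := k) (𝒜 := 𝒜)
        -- `s.obj X` may decompose, but one of its indecomposable summands still has image
        -- isomorphic to `X`.
        refine ⟨p.obj '' t, ht.image _, fun X hX => ?_⟩
        obtain ⟨Y, hY, ⟨f⟩⟩ := exists_isIndecomposable_of_map (k := k) p (s.obj X)
          (hX.of_iso (e.app X).symm)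
        obtain ⟨Z, hZ, ⟨g⟩⟩ := h Y hY
        exact ⟨_, ⟨Z, hZ, rfl⟩, ⟨(e.app X).symm ≪≫ f ≪≫ p.mapIso g⟩⟩ }

/-- The linear structure induced by a fully faithful functor. -/
abbrev linearOfFullyFaithful {ℰ : Type u₂} [Category.{v₂} ℰ] {F : ℰ ⥤ ℬ} (hF : F.FullyFaithful) :
    letI := Preadditive.ofFullyFaithful hF
    Linear k ℰ :=
  letI := Preadditive.ofFullyFaithful hF
  { homModule := fun X Y => hF.homEquiv.module k
    smul_comp := fun X Y Z r f g => hF.map_injective (by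
      simp [Equiv.smul_def])
    comp_smul := fun X Y Z f r g => hF.map_injective (by
      simp [Equiv.smul_def]) }

/-- A retract of a finitary category is equivalent to a finitary category in the same universes. -/
theorem exists_finAddCat_of_retract (A : FinAddCat.{w, v, u} k) (s : ℬ ⥤ A.carrier)
    (p : A.carrier ⥤ ℬ) [s.Additive] [s.Linear k] [p.Additive] (e : s ⋙ p ≅ 𝟭 ℬ) :
    ∃ (S : FinAddCat.{w, v, u} k) (F : S.carrier ⥤ ℬ), F.IsEquivalence ∧
      IsLinearFunctor k _ _ F := by
  have hs : s.Faithful := by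
    have : (s ⋙ p).Faithful := Functor.Faithful.of_iso e.symm
    exact Functor.Faithful.of_comp s p
  -- Taking the objects of `A` as names for their images under `p` fixes the object universe;
  -- faithfulness of `s` makes the morphism sets small. Nothing is lost, since `X ≅ p.obj (s.obj
  -- X)`.
  let I := InducedCategory ℬ p.obj
  have : LocallySmall.{v} I := ⟨fun X Y => small_of_injective
    (f := fun f : X ⟶ Y => s.map ((inducedFunctor p.obj).map f))
    (fun f g h => (inducedFunctor p.obj).map_injective (s.map_injective h))⟩
  let F : ShrinkHoms I ⥤ ℬ := (ShrinkHoms.equivalence.{v} I).inverse ⋙ inducedFunctor p.obj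
  let hF : F.FullyFaithful := .ofFullyFaithful F
  have : F.EssSurj := ⟨fun X => ⟨s.obj X, ⟨e.app X⟩⟩⟩
  have hE : F.IsEquivalence := {}
  let _ : Preadditive (ShrinkHoms I) := Preadditive.ofFullyFaithful hF
  let _ : Linear k (ShrinkHoms I) := linearOfFullyFaithful hF
  have hadd : F.Additive := hF.additive_ofFullyFaithful
  have hlin : F.Linear k := ⟨fun f r => hF.homEquiv.apply_symm_apply _⟩
  have hadd' : F.asEquivalence.functor.Additive := hadd
  have : F.inv.Additive := F.asEquivalence.inverse_additive
  have : IsFinitaryCategory k (ShrinkHoms I) := by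
    refine .of_retract (F ⋙ s) (p ⋙ F.inv) ?_
    exact Functor.associator _ _ _ ≪≫ Functor.isoWhiskerLeft F
      ((Functor.associator _ _ _).symm ≪≫ Functor.isoWhiskerRight e F.inv ≪≫ F.inv.leftUnitor) ≪≫
        F.asEquivalence.unitIso.symm
  exact ⟨⟨ShrinkHoms I⟩, F, hE, hadd, hlin⟩

end Finitary

/-! ### Linear structure on compatible families -/

section LinearFamilies

variable {k : Type w} [Field k] {C : Type u} [Bicategory.{w₁, v} C] {ι : Type u₁} {J : ι → C}
  {S : ι → Type a₁} [∀ i, Category.{b₁} (S i)] [∀ i, Preadditive (S i)] [∀ i, Linear k (S i)]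
  {T : ι → Type a₂} [∀ i, Category.{b₂} (T i)] [∀ i, Preadditive (T i)] [∀ i, Linear k (T i)]

namespace Family

section

variable {M : CatRep J S} {i : C}

section

variable [hM : ∀ {i j : ι} (F : J i ⟶ J j), (M.map F).Additive] (A B : Family M i)

instance : Zero (A ⟶ B) where
  zero :=
    { app := fun G => 0
      map_app := fun α => by simp
      act_app := fun G H => by simp }

instance : Add (A ⟶ B) where
  add f g :=
    { app := fun G => f.app G + g.app G
      map_app := fun α => by
        rw [Preadditive.comp_add, Preadditive.add_comp, f.map_app, g.map_app]
      act_app := fun G H => by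
        rw [Preadditive.comp_add, Functor.map_add, Preadditive.add_comp, f.act_app, g.act_app] }

instance : Neg (A ⟶ B) where
  neg f :=
    { app := fun G => - f.app G
      map_app := fun α => by rw [Preadditive.comp_neg, Preadditive.neg_comp, f.map_app]
      act_app := fun G H => by
        rw [Preadditive.comp_neg, Functor.map_neg, Preadditive.neg_comp, f.act_app] }

instance : AddCommGroup (A ⟶ B) where
  nsmul := nsmulRec
  zsmul := zsmulRec
  add_assoc f g h := hom_ext fun l G => add_assoc (f.app G) (g.app G) (h.app G)
  zero_add f := hom_ext fun l G => zero_add (f.app G)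
  add_zero f := hom_ext fun l G => add_zero (f.app G)
  add_comm f g := hom_ext fun l G => add_comm (f.app G) (g.app G)
  neg_add_cancel f := hom_ext fun l G => neg_add_cancel (f.app G)

end

instance preadditive [hM : ∀ {i j : ι} (F : J i ⟶ J j), (M.map F).Additive] :
    Preadditive (Family M i) where
  add_comp _ _ _ f f' g :=
    hom_ext fun l G => Preadditive.add_comp _ _ _ (f.app G) (f'.app G) (g.app G)
  comp_add _ _ _ f g g' :=
    hom_ext fun l G => Preadditive.comp_add _ _ _ (f.app G) (g.app G) (g'.app G)

instance linear [hM : ∀ {i j : ι} (F : J i ⟶ J j), (M.map F).Additive]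
    [hM' : ∀ {i j : ι} (F : J i ⟶ J j), (M.map F).Linear k] : Linear k (Family M i) where
  homModule A B :=
    { smul := fun r f =>
        { app := fun G => r • f.app G
          map_app := fun α => by rw [Linear.comp_smul, Linear.smul_comp, f.map_app]
          act_app := fun G H => by
            rw [Linear.comp_smul, Functor.map_smul, Linear.smul_comp, f.act_app] }
      one_smul := fun f => hom_ext fun l G => one_smul k (f.app G)
      mul_smul := fun r s f => hom_ext fun l G => mul_smul r s (f.app G)
      smul_zero := fun r => hom_ext fun l G => smul_zero r
      smul_add := fun r f g => hom_ext fun l G => smul_add r (f.app G) (g.app G)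
      add_smul := fun r s f => hom_ext fun l G => add_smul r s (f.app G)
      zero_smul := fun f => hom_ext fun l G => zero_smul k (f.app G) }
  smul_comp _ _ _ r f g :=
    hom_ext fun l G => Linear.smul_comp _ _ _ r (f.app G) (g.app G)
  comp_smul _ _ _ f r g :=
    hom_ext fun l G => Linear.comp_smul _ _ _ (f.app G) r (g.app G)

end

variable {M : CatRep J S} [hM : ∀ {i j : ι} (F : J i ⟶ J j), (M.map F).Additive]
    [hM' : ∀ {i j : ι} (F : J i ⟶ J j), (M.map F).Linear k]
  {N : CatRep J T} [hN : ∀ {i j : ι} (F : J i ⟶ J j), (N.map F).Additive]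
    [hN' : ∀ {i j : ι} (F : J i ⟶ J j), (N.map F).Linear k]

/-- The linear structure on families is memberwise, so this and the next lemma hold by definition.
-/
theorem isLinearFunctor_eval {i : C} {l : ι} (G : i ⟶ J l) :
    IsLinearFunctor k _ _ (eval M G) :=
  ⟨⟨rfl⟩, ⟨fun _ _ => rfl⟩⟩

theorem isLinearFunctor_rep_map {i j : C} (F : i ⟶ j) :
    IsLinearFunctor k _ _ ((rep M).map F) :=
  ⟨⟨rfl⟩, ⟨fun _ _ => rfl⟩⟩

theorem isLinearFunctor_ofObjTrans_app (l : ι) :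
    IsLinearFunctor k _ _ ((ofObjTrans M).app l) :=
  ⟨⟨hom_ext fun _ G => (M.map G).map_add⟩, ⟨fun f r => hom_ext fun _ G => (hM' G).map_smul f r⟩⟩

theorem isLinearFunctor_restrictedYoneda_app {U : C → Type a₁} [∀ i, Category.{b₁} (U i)]
    [∀ i, Preadditive (U i)] [∀ i, Linear k (U i)] {M : CatRep (fun i : C => i) U}
    [hM : ∀ {i j : ι} (F : J i ⟶ J j), ((M.restrict J).map F).Additive]
    [hM' : ∀ {i j : ι} (F : J i ⟶ J j), ((M.restrict J).map F).Linear k]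
    (h : ∀ {i j : C} (F : i ⟶ j), IsLinearFunctor k _ _ (M.map F)) (i : C) :
    IsLinearFunctor k _ _ ((restrictedYoneda M J).app i) :=
  ⟨⟨hom_ext fun _ G => (h G).1.map_add⟩,
    ⟨fun f r => hom_ext fun _ G => (h G).2.map_smul f r⟩⟩

theorem isLinearFunctor_imageTrans_app (Λ : CatTrans M N)
    (hΛ : ∀ l, IsLinearFunctor k _ _ (Λ.app l)) (i : C) :
    IsLinearFunctor k _ _ ((imageTrans Λ).app i) :=
  ⟨⟨hom_ext fun l _ => (hΛ l).1.map_add⟩,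
    ⟨fun f r => hom_ext fun l G => (hΛ l).2.map_smul (f.app G) r⟩⟩

end Family

theorem IsLinearFunctor.comp {𝒜 : Type a₁} [Category.{b₁} 𝒜] [Preadditive 𝒜] [Linear k 𝒜]
    {ℬ : Type a₂} [Category.{b₂} ℬ] [Preadditive ℬ] [Linear k ℬ]
    {𝒟 : Type a₃} [Category.{b₃} 𝒟] [Preadditive 𝒟] [Linear k 𝒟] {F : 𝒜 ⥤ ℬ} {G : ℬ ⥤ 𝒟}
    (hF : IsLinearFunctor k _ _ F) (hG : IsLinearFunctor k _ _ G) :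
    IsLinearFunctor k _ _ (F ⋙ G) :=
  have := hF.1
  have := hF.2
  have := hG.1
  have := hG.2
  ⟨inferInstance, inferInstance⟩

theorem IsLinearFunctor.inv {𝒜 : Type a₁} [Category.{b₁} 𝒜] [Preadditive 𝒜] [Linear k 𝒜]
    {ℬ : Type a₂} [Category.{b₂} ℬ] [Preadditive ℬ] [Linear k ℬ] {F : 𝒜 ⥤ ℬ}
    (hF : IsLinearFunctor k _ _ F) [F.IsEquivalence] : IsLinearFunctor k _ _ F.inv :=
  have : F.asEquivalence.functor.Additive := hF.1
  have : F.asEquivalence.functor.Linear k := hF.2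
  ⟨F.asEquivalence.inverse_additive, Equivalence.inverseLinear k F.asEquivalence⟩

end LinearFamilies

/-! ### Existence of retracts -/

section Retracts

variable {C : Type u} [Bicategory.{w, v} C]

/-- The object of the ambient 2-category underlying an object of a full 2-subcategory. -/
abbrev FullSub.val (D : Set C) (l : FullSub D) : C := l.1

theorem RetractLE.refl (i : C) : RetractLE i i := ⟨𝟙 i, 𝟙 i, ⟨λ_ _⟩⟩

theorem RetractLE.trans {i j l : C} (h : RetractLE i j) (h' : RetractLE j l) : RetractLE i l := by
  obtain ⟨Φ, Ψ, ⟨e⟩⟩ := h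
  obtain ⟨Φ', Ψ', ⟨e'⟩⟩ := h'
  exact ⟨Φ' ≫ Φ, Ψ ≫ Ψ', ⟨α_ _ _ _ ≪≫ whiskerLeftIso Ψ ((α_ _ _ _).symm ≪≫
    whiskerRightIso e' Φ ≪≫ λ_ Φ) ≪≫ e⟩⟩

theorem RetractLE.of_equivalence {i j : C} (e : i ≌ j) : RetractLE i j :=
  ⟨e.inv, e.hom, ⟨e.unit.symm⟩⟩

/-- In the finite set `s` some `m` above the representative of `i` is maximal within `s`. It is
maximal in `C`, because any object above it may be replaced by an equivalent member of `s`. -/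
theorem exists_retractLE_maximal {s : Set C} (hs : s.Finite)
    (h : ∀ i : C, ∃ j ∈ s, Nonempty (i ≌ j)) (i : C) :
    ∃ j : C, IsRetractMaximal j ∧ RetractLE i j := by
  let _ : Preorder C :=
    { le := RetractLE
      le_refl := RetractLE.refl
      le_trans := fun _ _ _ => RetractLE.trans }
  obtain ⟨i', hi', ⟨e⟩⟩ := h i
  obtain ⟨m, hm, hmax⟩ := hs.exists_le_maximal hi'
  refine ⟨m, fun j hj => ?_, (RetractLE.of_equivalence e).trans hm⟩
  obtain ⟨j', hj', ⟨e'⟩⟩ := h j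
  exact (RetractLE.of_equivalence e').trans
    (hmax.2 hj' (hj.trans (RetractLE.of_equivalence e')))

theorem nonempty_retractData {D : Set C} (hD : IsEssentialChoice D) {s : Set C} (hs : s.Finite)
    (h : ∀ i : C, ∃ j ∈ s, Nonempty (i ≌ j)) (i : C) :
    Nonempty (RetractData (FullSub.val D) i) := by
  obtain ⟨m, hm, him⟩ := exists_retractLE_maximal hs h i
  obtain ⟨j, hj, ⟨e⟩⟩ := hD.exists_equiv m hm
  obtain ⟨Φ, Ψ, ⟨f⟩⟩ := him.trans (RetractLE.of_equivalence e)
  exact ⟨⟨(⟨j, hj⟩ : D), Φ, Ψ, f⟩⟩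

end Retracts

/-! ### Restriction of 2-representations -/

section Restriction

variable {k : Type w} [Field k] {C : Type u} [Bicategory.{w₁, v} C] {D : Set C}

/-- The category-valued homomorphism underlying a 2-representation of a full 2-subcategory. -/
def CatRep.ofAfmodFull (M : Afmod.{w, w₁, v, v₂, u, u₂} k (FullSub D)) :
    CatRep (FullSub.val D) (fun l => (M.obj l).carrier) where
  map F := (M.map (InducedBicategory.mkHom F)).functor
  map₂ α X := (M.map₂ (InducedBicategory.mkHom₂ α)).natTrans.app X
  mapId l X := FinAddCat.isoApp (M.mapId l) X
  mapComp F G X :=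
    FinAddCat.isoApp (M.mapComp (InducedBicategory.mkHom F) (InducedBicategory.mkHom G)) X
  map₂_naturality α _ _ f := (ofAfmod M).map₂_naturality (InducedBicategory.mkHom₂ α) f
  map₂_id F X := (ofAfmod M).map₂_id (InducedBicategory.mkHom F) X
  map₂_comp α β X :=
    (ofAfmod M).map₂_comp (InducedBicategory.mkHom₂ α) (InducedBicategory.mkHom₂ β) X
  mapId_naturality f := (ofAfmod M).mapId_naturality f
  mapComp_naturality F G _ _ f :=
    (ofAfmod M).mapComp_naturality (InducedBicategory.mkHom F) (InducedBicategory.mkHom G) f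
  map₂_whiskerLeft F _ _ β X :=
    (ofAfmod M).map₂_whiskerLeft (InducedBicategory.mkHom F) (InducedBicategory.mkHom₂ β) X
  map₂_whiskerRight α G X :=
    (ofAfmod M).map₂_whiskerRight (InducedBicategory.mkHom₂ α) (InducedBicategory.mkHom G) X
  map₂_associator F G H X :=
    (ofAfmod M).map₂_associator (InducedBicategory.mkHom F) (InducedBicategory.mkHom G)
      (InducedBicategory.mkHom H) X
  map₂_leftUnitor F X := (ofAfmod M).map₂_leftUnitor (InducedBicategory.mkHom F) X
  map₂_rightUnitor F X := (ofAfmod M).map₂_rightUnitor (InducedBicategory.mkHom F) X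

/-- The inclusion is strict, so the unit constraint of the composite differs from that of `M` only
by the image of an identity. The same applies to `res_mapComp_hom`. -/
theorem res_mapId_hom (M : Afmod.{w, w₁, v, v₂, u, u₂} k C) (l : FullSub D) :
    (((res k D).obj M).mapId l).hom = (M.mapId l.1).hom :=
  (congrArg (· ≫ (M.mapId l.1).hom) (M.map₂_id _)).trans (Category.id_comp _)

theorem res_mapComp_hom (M : Afmod.{w, w₁, v, v₂, u, u₂} k C) {l m n : FullSub D} (F : l ⟶ m)
    (G : m ⟶ n) : (((res k D).obj M).mapComp F G).hom = (M.mapComp F.hom G.hom).hom :=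
  (congrArg (· ≫ (M.mapComp F.hom G.hom).hom) (M.map₂_id _)).trans (Category.id_comp _)

variable {M N : Afmod.{w, w₁, v, v₂, u, u₂} k C}

/-- The strong transformation of category-valued homomorphisms underlying a strong transformation
of restricted 2-representations. -/
def CatTrans.ofStrongTransRes (Λ : (res k D).obj M ⟶ (res k D).obj N) :
    CatTrans ((CatRep.ofAfmod M).restrict (FullSub.val D))
      ((CatRep.ofAfmod N).restrict (FullSub.val D)) where
  app l := (Λ.app l).functor
  nat F X := FinAddCat.isoApp (Λ.naturality (InducedBicategory.mkHom F)) X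
  nat_naturality F _ _ f :=
    (Λ.naturality (InducedBicategory.mkHom F)).hom.natTrans.naturality f
  nat_map₂ α X :=
    FinAddCat.congr_app (Λ.naturality_naturality (InducedBicategory.mkHom₂ α)) X
  nat_id l X :=
    (congrArg (_ ≫ ·) (FinAddCat.congr_app (res_mapId_hom N l) ((Λ.app l).functor.obj X)).symm).trans
      (((ofStrongTrans Λ).nat_id l X).trans
        (congrArg (Λ.app l).functor.map (FinAddCat.congr_app (res_mapId_hom M l) X)))
  nat_comp {i _ l} F G X :=
    (congrArg (_ ≫ ·) (FinAddCat.congr_app (res_mapComp_hom N (InducedBicategory.mkHom F)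
      (InducedBicategory.mkHom G)) ((Λ.app i).functor.obj X)).symm).trans
      (((ofStrongTrans Λ).nat_comp (InducedBicategory.mkHom F) (InducedBicategory.mkHom G) X).trans
        (congrArg (· ≫ _) (congrArg (Λ.app l).functor.map (FinAddCat.congr_app
          (res_mapComp_hom M (InducedBicategory.mkHom F) (InducedBicategory.mkHom G)) X))))

/-- The strong transformation to a restricted 2-representation with given linear components. -/
def CatTrans.toStrongTransRes {M : Afmod.{w, w₁, v, v₂, u, u₂} k (FullSub D)}
    (Λ : CatTrans (CatRep.ofAfmodFull M) ((CatRep.ofAfmod N).restrict (FullSub.val D)))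
    (hΛ : ∀ l, IsLinearFunctor k _ _ (Λ.app l)) : M ⟶ (res k D).obj N :=
  CatTrans.toStrongTrans (M := M) (N := (res k D).obj N)
    { app := fun l => Λ.app l
      nat := fun F X => Λ.nat F.hom X
      nat_naturality := fun F _ _ f => Λ.nat_naturality F.hom f
      nat_map₂ := fun α X => Λ.nat_map₂ α.hom X
      nat_id := fun l X =>
        (congrArg (_ ≫ ·) (FinAddCat.congr_app (res_mapId_hom N l) ((Λ.app l).obj X))).trans
          (Λ.nat_id l X)
      nat_comp := fun {i _ _} F G X =>
        (congrArg (_ ≫ ·) (FinAddCat.congr_app (res_mapComp_hom N F G) ((Λ.app i).obj X))).trans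
          (Λ.nat_comp F.hom G.hom X) } hΛ

instance additive_restrict_ofAfmod_map (M : Afmod.{w, w₁, v, v₂, u, u₂} k C) {ι : Type u₁}
    (J : ι → C) {i j : ι} (F : J i ⟶ J j) :
    (((CatRep.ofAfmod M).restrict J).map F).Additive :=
  (M.map F).property.1

instance linear_restrict_ofAfmod_map (M : Afmod.{w, w₁, v, v₂, u, u₂} k C) {ι : Type u₁}
    (J : ι → C) {i j : ι} (F : J i ⟶ J j) :
    (((CatRep.ofAfmod M).restrict J).map F).Linear k :=
  (M.map F).property.2

instance additive_ofAfmodFull_map (M : Afmod.{w, w₁, v, v₂, u, u₂} k (FullSub D))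
    {i j : FullSub D} (F : FullSub.val D i ⟶ FullSub.val D j) :
    ((CatRep.ofAfmodFull M).map F).Additive :=
  (M.map (InducedBicategory.mkHom F)).property.1

instance linear_ofAfmodFull_map (M : Afmod.{w, w₁, v, v₂, u, u₂} k (FullSub D))
    {i j : FullSub D} (F : FullSub.val D i ⟶ FullSub.val D j) :
    ((CatRep.ofAfmodFull M).map F).Linear k :=
  (M.map (InducedBicategory.mkHom F)).property.2

/-- A morphism of families with invertible members is invertible. -/
theorem Family.isIso_of_app {ι : Type u₁} {J : ι → C} {S : ι → Type a₁} [∀ i, Category.{b₁} (S i)]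
    {M : CatRep J S} {i : C} {A B : Family M i} (f : A ⟶ B)
    (h : ∀ (l : ι) (G : i ⟶ J l), IsIso (f.app G)) : IsIso f :=
  (isoMk (fun {l} G => have := h l G; asIso (f.app G)) f.map_app f.act_app).isIso_hom

/-! ### The restriction is a local equivalence -/

theorem faithful_res_mapFunctor (r : ∀ i, RetractData (FullSub.val D) i)
    (M N : Afmod.{w, w₁, v, v₂, u, u₂} k C) :
    ((res k D).mapFunctor M N).Faithful := ⟨fun {Λ Θ Γ Γ'} h => by
  ext i : 1
  refine FinAddCat.hom₂_ext fun X => ?_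
  refine CatMod.eq_of_restrict_eq r (Γ := CatMod.ofModification Γ)
    (Γ' := CatMod.ofModification Γ') (fun l X => ?_) i X
  exact FinAddCat.congr_app (congrArg (fun γ => γ.as.app l) h) X⟩

theorem full_res_mapFunctor (r : ∀ i, RetractData (FullSub.val D) i)
    (M N : Afmod.{w, w₁, v, v₂, u, u₂} k C) :
    ((res k D).mapFunctor M N).Full := ⟨fun {Λ Θ} Γ => by
  let Γ' : CatMod ((CatTrans.ofStrongTrans Λ).restrict (FullSub.val D))
      ((CatTrans.ofStrongTrans Θ).restrict (FullSub.val D)) :=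
    { app := fun l X => (Γ.as.app l).natTrans.app X
      naturality := fun {l _ _} f => (Γ.as.app l).natTrans.naturality f
      app_map := fun F X =>
        FinAddCat.congr_app (Γ.as.naturality (InducedBicategory.mkHom F)) X }
  refine ⟨(Γ'.extend r).toModification, ?_⟩
  ext l : 1
  exact FinAddCat.hom₂_ext fun X => Γ'.extend_app r l X⟩

/-- The preimage of `Λ` is its extension through families. It is linear as a composite of linear
functors with the inverse of one. -/
theorem essSurj_res_mapFunctor (r : ∀ i, RetractData (FullSub.val D) i)
    (M N : Afmod.{w, w₁, v, v₂, u, u₂} k C) :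
    ((res k D).mapFunctor M N).EssSurj := ⟨fun Λ => by
  have := fun i => Family.isEquivalence_restrictedYoneda_app (CatRep.ofAfmod N) (r i)
  let q := fun i => AdjInverse.ofIsEquivalence
    ((Family.restrictedYoneda (CatRep.ofAfmod N) (FullSub.val D)).app i)
  let Λ' := CatTrans.ofStrongTransRes Λ
  have hlin : ∀ i, IsLinearFunctor k _ _ ((Λ'.extend q).app i) := fun i =>
    ((Family.isLinearFunctor_restrictedYoneda_app (M := CatRep.ofAfmod M)
        (fun F => (M.map F).property) i).comp
      (Family.isLinearFunctor_imageTrans_app Λ' (fun l => (Λ.app l).property) i)).comp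
      (Family.isLinearFunctor_restrictedYoneda_app (M := CatRep.ofAfmod N)
        (fun F => (N.map F).property) i).inv
  let σ := Λ'.extendRestrict q
  -- The component is a functor applied to a morphism of families with members `Λ'.nat G X`,
  -- followed by an inverse unit.
  have hσ : ∀ l X, IsIso (σ.app l X) := fun l X => by
    have h : IsIso (Λ'.yonedaMod.app l X) := Family.isIso_of_app _ fun m G =>
      (Λ'.nat G X).isIso_hom
    have h' : IsIso ((q l.1).inv.map (Λ'.yonedaMod.app l X)) := inferInstance
    exact IsIso.comp_isIso' h' (Iso.isIso_inv _)
  refine ⟨(Λ'.extend q).toStrongTrans hlin, ⟨?_⟩⟩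
  exact Pseudofunctor.StrongTrans.isoMk
    (fun l => FinAddCat.isoOfComponents (fun X => @asIso _ _ _ _ (σ.app l X) (hσ l X))
      (fun f => σ.naturality f))
    (fun F => FinAddCat.hom₂_ext (σ.app_map F.hom))⟩

theorem isEquivalence_res_mapFunctor (r : ∀ i, RetractData (FullSub.val D) i)
    (M N : Afmod.{w, w₁, v, v₂, u, u₂} k C) :
    ((res k D).mapFunctor M N).IsEquivalence where
  faithful := faithful_res_mapFunctor r M N
  full := full_res_mapFunctor r M N
  essSurj := essSurj_res_mapFunctor r M N

end Restriction

/-! ### Additivity of compatible families -/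

section FamilyLinear

variable {k : Type w} [Field k] {C : Type u} [Bicategory.{w₁, v} C] {ι : Type u₁} {J : ι → C}
  {S : ι → Type a₁} [∀ i, Category.{b₁} (S i)]

/-- The members of a family, expressed by its value at the inclusion of a retract. -/
def Family.retractIso {M : CatRep J S} {i : C} (r : RetractData J i) (A : Family M i) {l : ι}
    (G : i ⟶ J l) : (M.map (r.proj ≫ G)).obj (A.obj r.incl) ≅ A.obj G :=
  (eval M G).mapIso ((alongEvalIso M r).app A)

/-- Conjugating by the retraction rewrites `A.map α` through `M.map₂` of a left whiskering, so
additivity and linearity of `A.map` follow from those of `M` and of whiskering. -/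
theorem Family.map_eq_of_retract {M : CatRep J S} {i : C} (r : RetractData J i) (A : Family M i)
    {l : ι} {G G' : i ⟶ J l} (α : G ⟶ G') :
    A.map α = (A.retractIso r G).inv ≫ M.map₂ (r.proj ◁ α) (A.obj r.incl) ≫
      (A.retractIso r G').hom := by
  rw [Iso.eq_inv_comp]
  exact (((alongEvalIso M r).hom.app A).map_app α).symm

variable [∀ i, Preadditive (S i)]
  [∀ i j : C, Preadditive (i ⟶ j)] [∀ i j : C, Linear k (i ⟶ j)]

theorem Family.map_add_of_retract [IsFinitaryTwoCategory k C] {M : CatRep J S}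
    (hM : ∀ {l m : ι} {F G : J l ⟶ J m} (α β : F ⟶ G) (X : S l),
      M.map₂ (α + β) X = M.map₂ α X + M.map₂ β X) {i : C}
    (r : RetractData J i) (A : Family M i) {l : ι} {G G' : i ⟶ J l} (α β : G ⟶ G') :
    A.map (α + β) = A.map α + A.map β := by
  simp only [A.map_eq_of_retract r, IsFinitaryTwoCategory.whiskerLeft_add (k := k), hM,
    Preadditive.add_comp, Preadditive.comp_add]

theorem Family.map_smul_of_retract [∀ i, Linear k (S i)] [IsFinitaryTwoCategory k C] {M : CatRep J S}
    (hM : ∀ {l m : ι} {F G : J l ⟶ J m} (c : k) (α : F ⟶ G) (X : S l),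
      M.map₂ (c • α) X = c • M.map₂ α X) {i : C}
    (r : RetractData J i) (A : Family M i) {l : ι} {G G' : i ⟶ J l} (c : k) (α : G ⟶ G') :
    A.map (c • α) = c • A.map α := by
  simp only [A.map_eq_of_retract r, IsFinitaryTwoCategory.whiskerLeft_smul, hM,
    Linear.smul_comp, Linear.comp_smul]

end FamilyLinear

/-! ### Essential surjectivity of the restriction -/

section EssentialSurjectivity

variable {k : Type w} [Field k] {C : Type u} [Bicategory.{w₁, v} C]

/-- An equivalence, with its direction reversed. -/
def reverseEquivalence {a b : C} (e : a ≌ b) : b ≌ a :=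
  Bicategory.Equivalence.mkOfAdjointifyCounit e.counit.symm e.unit.symm

variable {D : Set C}

instance additive_along (M : Afmod.{w, w₁, v, v₂, u, u₂} k (FullSub D)) {l : FullSub D} {i : C}
    (F : FullSub.val D l ⟶ i) : (Family.along (CatRep.ofAfmodFull M) F).Additive :=
  ((Family.isLinearFunctor_ofObjTrans_app (k := k) (M := CatRep.ofAfmodFull M) l).comp
    (Family.isLinearFunctor_rep_map F)).1

/-- A finitary model of the category of compatible families. -/
theorem exists_family_model (M : Afmod.{w, w₁, v, v₂, u, u₂} k (FullSub D)) {i : C}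
    (r : RetractData (FullSub.val D) i) :
    ∃ (S : FinAddCat.{w, v₂, u₂} k) (F : S.carrier ⥤ Family (CatRep.ofAfmodFull M) i),
      F.IsEquivalence ∧ IsLinearFunctor k _ _ F :=
  have := (Family.isLinearFunctor_eval (k := k) (M := CatRep.ofAfmodFull M) r.incl).1
  have := (Family.isLinearFunctor_eval (k := k) (M := CatRep.ofAfmodFull M) r.incl).2
  exists_finAddCat_of_retract (M.obj r.index) (Family.eval (CatRep.ofAfmodFull M) r.incl)
    (Family.along (CatRep.ofAfmodFull M) r.proj) (Family.alongEvalIso (CatRep.ofAfmodFull M) r)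

variable (M : Afmod.{w, w₁, v, v₂, u, u₂} k (FullSub D)) {S : C → FinAddCat.{w, v₂, u₂} k}
  (e : ∀ i, (S i).carrier ⥤ Family (CatRep.ofAfmodFull M) i) [∀ i, (e i).IsEquivalence]

/-- The extension to `C` of a 2-representation of a full 2-subcategory, on finitary models of the
categories of compatible families. -/
def extendRep : CatRep (fun i : C => i) (fun i => (S i).carrier) :=
  (Family.rep (CatRep.ofAfmodFull M)).transport (fun i => AdjInverse.ofIsEquivalence (e i))

theorem isLinearFunctor_extendRep_map (hl : ∀ i, IsLinearFunctor k _ _ (e i)) {i j : C}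
    (F : i ⟶ j) : IsLinearFunctor k _ _ ((extendRep M e).map F) :=
  (hl i).comp ((Family.isLinearFunctor_rep_map F).comp (hl j).inv)

/-- The 2-representation given by `extendRep`. -/
def extendAfmod (hl : ∀ i, IsLinearFunctor k _ _ (e i)) :
    Afmod.{w, w₁, v, v₂, u, u₂} k C :=
  (extendRep M e).toAfmod fun F => isLinearFunctor_extendRep_map M e hl F

theorem nonempty_equivalence_res_extendAfmod (hl : ∀ i, IsLinearFunctor k _ _ (e i)) :
    Nonempty ((res k D).obj (extendAfmod M e hl) ≌ M) := by
  let R := CatRep.ofAfmodFull M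
  let E : CatTrans (extendRep M e) (Family.rep R) :=
    (Family.rep R).transportTrans (fun i => AdjInverse.ofIsEquivalence (e i))
  -- The Yoneda transformation of `R`, an equivalence at every object of `D`, followed by the
  -- passage from families back to their finitary models.
  let P : CatTrans R ((extendRep M e).restrict (FullSub.val D)) :=
    (Family.ofObjTrans R).comp ((E.restrict (FullSub.val D)).inverse
      (fun l => AdjInverse.ofIsEquivalence (e l.1)))
  have hP : ∀ l, IsLinearFunctor k _ _ (P.app l) := fun l =>
    (Family.isLinearFunctor_ofObjTrans_app l).comp (hl l.1).inv
  let Λ : M ⟶ (res k D).obj (extendAfmod M e hl) :=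
    CatTrans.toStrongTransRes (N := extendAfmod M e hl) P hP
  obtain ⟨q⟩ := nonempty_equivalence_of_isEquivalence Λ (fun l =>
    inferInstanceAs ((Family.ofObjTrans R).app l ⋙ (e l.1).inv).IsEquivalence)
  exact ⟨reverseEquivalence q⟩

variable [∀ i j : C, Preadditive (i ⟶ j)] [∀ i j : C, Linear k (i ⟶ j)]
  [IsFinitaryTwoCategory k C]

/-- On families a 2-morphism `α` acts through `A.map (α ▷ H)`: right whiskering is linear in `C`,
and `A.map` is linear by the retraction. -/
theorem extendAfmod_mem_linearReps (hl : ∀ i, IsLinearFunctor k _ _ (e i))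
    (r : ∀ i, RetractData (FullSub.val D) i)
    (hM : M ∈ linearReps k (FullSub D)) : extendAfmod M e hl ∈ linearReps k C := by
  have hadd {l m : FullSub D} {F G : FullSub.val D l ⟶ FullSub.val D m} (α β : F ⟶ G)
      (X : (M.obj l).carrier) : (CatRep.ofAfmodFull M).map₂ (α + β) X =
        (CatRep.ofAfmodFull M).map₂ α X + (CatRep.ofAfmodFull M).map₂ β X :=
    FinAddCat.congr_app ((hM l m).1.map_add (f := InducedBicategory.mkHom₂ α)
      (g := InducedBicategory.mkHom₂ β)) X
  have hsmul {l m : FullSub D} {F G : FullSub.val D l ⟶ FullSub.val D m} (c : k) (α : F ⟶ G)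
      (X : (M.obj l).carrier) : (CatRep.ofAfmodFull M).map₂ (c • α) X =
        c • (CatRep.ofAfmodFull M).map₂ α X :=
    FinAddCat.congr_app ((hM l m).2.map_smul (InducedBicategory.mkHom₂ α) c) X
  intro i j
  have hadd' {F G : i ⟶ j} (α β : F ⟶ G) (A : Family (CatRep.ofAfmodFull M) i) :
      (Family.rep _).map₂ (α + β) A = (Family.rep _).map₂ α A + (Family.rep _).map₂ β A :=
    Family.hom_ext fun l H =>
      (congrArg A.map (IsFinitaryTwoCategory.add_whiskerRight (k := k) α β H)).trans
        (A.map_add_of_retract (k := k) hadd (r i) _ _)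
  have hsmul' {F G : i ⟶ j} (c : k) (α : F ⟶ G) (A : Family (CatRep.ofAfmodFull M) i) :
      (Family.rep _).map₂ (c • α) A = c • (Family.rep _).map₂ α A :=
    Family.hom_ext fun l H =>
      (congrArg A.map (IsFinitaryTwoCategory.smul_whiskerRight c α H)).trans
        (A.map_smul_of_retract hsmul (r i) _ _)
  exact
    ⟨⟨fun {F G α β} => FinAddCat.hom₂_ext fun X =>
      (congrArg (e j).inv.map (hadd' α β _)).trans (hl j).inv.1.map_add⟩,
    ⟨fun α c => FinAddCat.hom₂_ext fun X =>
      (congrArg (e j).inv.map (hsmul' c α _)).trans ((hl j).inv.2.map_smul _ c)⟩⟩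

end EssentialSurjectivity

/-! ### Biequivalences -/

section Biequivalences

/-- Morphism categories are unchanged in full 2-subcategories, so only essential surjectivity needs
a separate hypothesis: preimages of objects of `Q` must be found in `P`. -/
theorem IsBiequivalence.restrictFull {A : Type u} [Bicategory.{w, v} A] {B : Type u₁}
    [Bicategory.{w₁, v₁} B] {H : A ⥤ᵖ B} (hH : ∀ a a' : A, (H.mapFunctor a a').IsEquivalence)
    {P : Set A} {Q : Set B} (h : ∀ a ∈ P, H.obj a ∈ Q)
    (hs : ∀ b ∈ Q, ∃ a ∈ P, Nonempty (H.obj a ≌ b)) :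
    IsBiequivalence (restrictFull H P Q h) where
  essSurj b := by
    obtain ⟨a, ha, ⟨e⟩⟩ := hs b.1 b.2
    refine ⟨(⟨a, ha⟩ : P), ⟨Bicategory.Equivalence.mkOfAdjointifyCounit
      (f := InducedBicategory.mkHom e.hom) (g := InducedBicategory.mkHom e.inv)
      (InducedBicategory.isoMk e.unit) (InducedBicategory.isoMk e.counit)⟩⟩
  localEquiv a a' :=
    have := hH a.1 a'.1
    { faithful := ⟨fun {F G α β} hαβ => InducedBicategory.hom₂_ext
        ((H.mapFunctor a.1 a'.1).map_injective (congrArg (fun γ => γ.hom) hαβ))⟩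
      full := ⟨fun {F G} β => by
        obtain ⟨α, hα⟩ := (H.mapFunctor a.1 a'.1).map_surjective β.hom
        exact ⟨⟨α⟩, InducedBicategory.hom₂_ext hα⟩⟩
      essSurj := ⟨fun F => ⟨InducedBicategory.mkHom ((H.mapFunctor a.1 a'.1).objPreimage F.hom),
        ⟨InducedBicategory.isoMk ((H.mapFunctor a.1 a'.1).objObjPreimageIso F.hom)⟩⟩⟩ }

variable {k : Type w} [Field k] {C : Type u} [Bicategory.{w₁, v} C] {D : Set C}

theorem isBiequivalence_res (r : ∀ i, RetractData (FullSub.val D) i) :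
    IsBiequivalence (res.{w, w₁, v, v₂, u, u₂} k D) where
  essSurj M := by
    choose S e he hl using fun i => exists_family_model M (r i)
    exact ⟨extendAfmod M e hl, nonempty_equivalence_res_extendAfmod M e hl⟩
  localEquiv := isEquivalence_res_mapFunctor r

theorem isBiequivalence_linearRes [∀ i j : C, Preadditive (i ⟶ j)]
    [∀ i j : C, Linear k (i ⟶ j)] [IsFinitaryTwoCategory k C]
    (r : ∀ i, RetractData (FullSub.val D) i) :
    IsBiequivalence (linearRes.{w, w₁, v, v₂, u, u₂} k D) :=
  IsBiequivalence.restrictFull (isEquivalence_res_mapFunctor r) _ fun M hM => by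
    choose S e he hl using fun i => exists_family_model M (r i)
    exact ⟨extendAfmod M e hl, extendAfmod_mem_linearReps M e hl r hM,
      nonempty_equivalence_res_extendAfmod M e hl⟩

end Biequivalences

end FinitaryMorita

end

theorem mainTheorem6 (k : Type w) [Field k] [IsAlgClosed k]
    (C : Type u) [Bicategory.{w₁, v} C]
    [∀ i j : C, Preadditive (i ⟶ j)] [∀ i j : C, Linear k (i ⟶ j)]
    [FinitaryMorita.IsFinitaryTwoCategory k C]
    (D : Set C) (hD : FinitaryMorita.IsEssentialChoice D) :
    FinitaryMorita.IsBiequivalence (FinitaryMorita.res.{w, w₁, v, v₂, u, u₂} k D) ∧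
    FinitaryMorita.IsBiequivalence (FinitaryMorita.linearRes.{w, w₁, v, v₂, u, u₂} k D) := by
  obtain ⟨s, hs, h⟩ := FinitaryMorita.IsFinitaryTwoCategory.finite_objects (k := k) (C := C)
  let r := fun i => (FinitaryMorita.nonempty_retractData hD hs h i).some
  exact ⟨FinitaryMorita.isBiequivalence_res r, FinitaryMorita.isBiequivalence_linearRes r⟩
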